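/- **Setting.** On $2\times2$ real matrices put $\langle a,b\rangle=-\tfrac12\operatorname{Trace}(\operatorname{adj}(a)\,b)$. Tangent vectors of $\mathrm{SL}(2,\mathbb R)\times\mathrm{SL}(2,\mathbb R)$ at $(a,b)$ are written $(a\alpha,b\beta)$ with $\alpha,\beta\in\mathfrak{sl}(2,\mathbb R)$. Let $$P(a\alpha,b\beta)=(a\beta,b\alpha),\qquad J(a\alpha,b\beta)=\tfrac1{\sqrt3}\bigl(a(\alpha-2\beta),\,b(2\alpha-\beta)\bigr),$$ and let $g$ be the pseudo-nearly Kähler metric $g(X,Y)=\tfrac23\langle X,Y\rangle-\tfrac13\langle PX,Y\rangle$, where $\langle\cdot,\cdot\rangle$ on pairs is the product metric, with Levi-Civita connection $\tilde\nabla$. Let $\phi_1(p,q)=(q,p)$ and $\phi_2(p,q)=(p^{-1},qp^{-1})$. A smooth immersion $f:M\to\mathrm{SL}(2,\mathbb R)\times\mathrm{SL}(2,\mathbb R)$ of a 3-manifold is *Lagrangian* if the induced metric is non-degenerate and $J$ maps tangent spaces of $M$ to normal spaces. It is *totally geodesic* if its second fundamental form (the normal part of $\tilde\nabla_X\,df(Y)$)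 vanishes. For a Lagrangian immersion there are unique $A,B:TM\to TM$ with $P|_{TM}=A+JB$. The immersion is *of diagonalizable type* if around each point of $M$ there is a smooth frame $\{E_1,E_2,E_3\}$ which is $\Delta_1$-orthonormal (that is, $g(E_i,E_j)=\pm\delta_{ij}$, with sign $-$ for $i=1$ and $+$ for $i=2,3$) and such that $AE_i=\cos(2\theta_i)E_i$, $BE_i=\sin(2\theta_i)E_i$ for some real functions $\theta_1,\theta_2,\theta_3$. We call this a diagonalizing frame, with angle functions $\theta_i$ (determined modulo $\pi$). **Lemma.** Let $M$ be connected and let $f:M\to\mathrm{SL}(2,\mathbb R)\times\mathrm{SL}(2,\mathbb R)$ be a totally geodesic Lagrangian immersion of diagonalizable type. Then there are an isometry $\phi$ of $(\mathrm{SL}(2,\mathbb R)\times\mathrm{SL}(2,\mathbb R),g)$ belonging to the group generated by $\phi_1$ and $\phi_2$, such that $\phi\circ f$ is again a Lagrangian immersion, and one of the three triples $$(c_1,c_2,c_3)=\bigl(\tfrac{4\pi}3,\tfrac{4\pi}3,\tfrac{4\pi}3\bigr),\qquad(0,\pi,\pi),\qquad(\pi,\pi,0),$$ with the following property. For every diagonalizing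 frame $\{E_1,E_2,E_3\}$ of $f$ on a connected open set $U\subseteq M$, one of the frames $\{E_1,E_2,E_3\}$ and $\{E_1,E_3,-E_2\}$ is a diagonalizing frame of $\phi\circ f$ on $U$ with constant angle functions satisfying $(2\theta_1,2\theta_2,2\theta_3)=(c_1,c_2,c_3)$ on $U$. -/

import Mathlib

open scoped Manifold ContDiff MatrixGroups

noncomputable section

namespace PseudoNK

/-! ## The ambient space `SL(2,ℝ) × SL(2,ℝ)` -/

/-- The real `2 × 2` matrices. -/
abbrev Mat2 : Type := Matrix (Fin 2) (Fin 2) ℝ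

/-- Pairs of `2 × 2` matrices, for the algebra. -/
abbrev MatPair : Type := Mat2 × Mat2

/-- Pairs of `2 × 2` arrays of real numbers, for the calculus: the vector space `ℝ⁸` in which
`SL(2,ℝ) × SL(2,ℝ)` is a closed submanifold. (Matrices carry no standing norm in Mathlib.) -/
abbrev Vec : Type := (Fin 2 → Fin 2 → ℝ) × (Fin 2 → Fin 2 → ℝ)

/-- The entries of a pair of matrices. -/
def toVec (ξ : MatPair) : Vec := (fun i j => ξ.1 i j, fun i j => ξ.2 i j)

/-- The pair of matrices with given entries. -/
def ofVec (x : Vec) : MatPair := (Matrix.of x.1, Matrix.of x.2)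

/-- The ambient group `SL(2,ℝ) × SL(2,ℝ)`. -/
abbrev Amb : Type := SL(2, ℝ) × SL(2, ℝ)

/-- The inclusion of `SL(2,ℝ) × SL(2,ℝ)` into `ℝ⁸`. -/
def incl (x : Amb) : Vec := toVec ((x.1 : Mat2), (x.2 : Mat2))

/-- Left translation `(α, β) ↦ (aα, bβ)` by `x = (a, b)`. The tangent space at `x` consists of
the vectors `(aα, bβ)` with `α, β` in `𝔰𝔩(2,ℝ)`. -/
def leftTr (x : Amb) (ξ : MatPair) : MatPair := ((x.1 : Mat2) * ξ.1, (x.2 : Mat2) * ξ.2)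

/-- The Lie algebra `𝔰𝔩(2,ℝ) × 𝔰𝔩(2,ℝ)`: pairs of trace-free matrices. -/
def IsTraceFree (ξ : MatPair) : Prop := ξ.1.trace = 0 ∧ ξ.2.trace = 0

/-! Tangent vectors `(aα, bβ)` at `(a, b)` are recorded below by their left translates `(α, β)`
to the identity. All tensors of the ambient space are left-invariant, so they are given by the
same formula at each point. -/

/-- The inner product `⟨a, b⟩ = -(1/2) trace (adj a · b)` on `2 × 2` matrices. -/
def ip (a b : Mat2) : ℝ := -(1 / 2) * (a.adjugate * b).trace

/-- The inner product is invariant under left translation by `SL(2,ℝ)`. -/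
theorem ip_left_invariant (a : SL(2, ℝ)) (α γ : Mat2) :
    ip ((a : Mat2) * α) ((a : Mat2) * γ) = ip α γ := by
  have h : (a : Mat2).adjugate * (a : Mat2) = 1 := by
    rw [Matrix.adjugate_mul, a.det_coe, one_smul]
  unfold ip
  rw [Matrix.adjugate_mul_distrib, Matrix.mul_assoc, ← Matrix.mul_assoc _ _ γ, h,
    Matrix.one_mul]

/-- The product metric of `SL(2,ℝ) × SL(2,ℝ)`. -/
def prodMetric (ξ η : MatPair) : ℝ := ip ξ.1 η.1 + ip ξ.2 η.2

/-- The almost product structure `P (aα, bβ) = (aβ, bα)`. -/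
def opP (ξ : MatPair) : MatPair := (ξ.2, ξ.1)

/-- The almost complex structure `J (aα, bβ) = (1/√3) (a(α - 2β), b(2α - β))`. -/
def opJ (ξ : MatPair) : MatPair :=
  (1 / Real.sqrt 3) • (ξ.1 - (2 : ℝ) • ξ.2, (2 : ℝ) • ξ.1 - ξ.2)

/-- The pseudo-nearly Kähler metric
`g((aα, bβ), (aγ, bδ)) = (2/3) ⟨(aα, bβ), (aγ, bδ)⟩ - (1/3) ⟨(aβ, bα), (aγ, bδ)⟩`. -/
def nkMetric (ξ η : MatPair) : ℝ := 2 / 3 * prodMetric ξ η - 1 / 3 * prodMetric (opP ξ) η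

/-- The bracket of the Lie algebra of the ambient group. -/
def br (ξ η : MatPair) : MatPair := (⁅ξ.1, η.1⁆, ⁅ξ.2, η.2⁆)

/-- The Levi-Civita connection of `g` on left-invariant vector fields. It is the bilinear map
determined by the two properties proved below: absence of torsion and metric compatibility. -/
def lcConn (ξ η : MatPair) : MatPair :=
  ((1 / 2 : ℝ) • ⁅ξ.1, η.1⁆ - (1 / 6 : ℝ) • (⁅ξ.1, η.2⁆ + ⁅η.1, ξ.2⁆),
   (1 / 2 : ℝ) • ⁅ξ.2, η.2⁆ + (1 / 6 : ℝ) • (⁅ξ.1, η.2⁆ + ⁅η.1, ξ.2⁆))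

theorem lcConn_torsion_free (ξ η : MatPair) : lcConn ξ η - lcConn η ξ = br ξ η := by
  ext i j <;> fin_cases i <;> fin_cases j <;>
    simp [lcConn, br, Ring.lie_def, Matrix.mul_apply, Fin.sum_univ_two] <;> ring

theorem lcConn_metric (ζ ξ η : MatPair) :
    nkMetric (lcConn ζ ξ) η + nkMetric ξ (lcConn ζ η) = 0 := by
  have key : ∀ a b : Mat2,
      ip a b = -(1 / 2) * (a 1 1 * b 0 0 - a 0 1 * b 1 0 - a 1 0 * b 0 1 + a 0 0 * b 1 1) := by
    intro a b
    rw [ip, Matrix.adjugate_fin_two, Matrix.trace_fin_two]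
    simp only [Matrix.mul_apply, Fin.sum_univ_two, Matrix.of_apply, Matrix.cons_val_zero,
      Matrix.cons_val_one]
    ring
  simp only [nkMetric, prodMetric, opP, key, lcConn, Ring.lie_def, Matrix.add_apply,
    Matrix.sub_apply, Matrix.smul_apply, smul_eq_mul, Matrix.mul_apply, Fin.sum_univ_two]
  ring

/-! ### Isometries -/

/-- The map `(p, q) ↦ (q, p)`. -/
def phi1 : Equiv.Perm Amb := Equiv.prodComm _ _

/-- The map `(p, q) ↦ (p⁻¹, q p⁻¹)`; it is an involution. -/
def phi2 : Equiv.Perm Amb where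
  toFun x := (x.1⁻¹, x.2 * x.1⁻¹)
  invFun x := (x.1⁻¹, x.2 * x.1⁻¹)
  left_inv x := by simp
  right_inv x := by simp

/-- A bijection of the ambient space is an isometry if it is smooth (as a map of closed
submanifolds of a Euclidean space: the restriction of a smooth map) and its differential preserves
`g` on all tangent spaces. -/
def IsAmbIsometry (φ : Equiv.Perm Amb) : Prop :=
  ∃ Φ : Vec → Vec, ContDiff ℝ ∞ Φ ∧ (∀ x, Φ (incl x) = incl (φ x)) ∧
    ∀ x ξ η, IsTraceFree ξ → IsTraceFree η →
      nkMetric (leftTr (φ x)⁻¹ (ofVec (fderiv ℝ Φ (incl x) (toVec (leftTr x ξ)))))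
        (leftTr (φ x)⁻¹ (ofVec (fderiv ℝ Φ (incl x) (toVec (leftTr x η))))) = nkMetric ξ η

/-! ## Submanifolds -/

section Submanifolds

variable {M : Type*} [TopologicalSpace M] [ChartedSpace (EuclideanSpace ℝ (Fin 3)) M]

/-- The differential `df_p(v)`, left translated to the identity: if `f = (a, b)` and
`df_p(v) = (a(p) α, b(p) β)` then this is `(α, β)`. -/
def dL (f : M → Amb) (p : M) (v : TangentSpace (𝓡 3) p) : MatPair :=
  leftTr (f p)⁻¹ (ofVec (mfderiv (𝓡 3) 𝓘(ℝ, Vec) (fun q => incl (f q)) p v))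

/-- `f` is a Lagrangian immersion of the 3-manifold `M`: smooth, immersive, non-degenerate, and `J`
maps tangent vectors to normal vectors. Since `dim M` is half of the ambient dimension, `J` then
also maps the normal spaces onto the tangent spaces. -/
structure IsLagrangianImmersion (f : M → Amb) : Prop where
  smooth : ContMDiff (𝓡 3) 𝓘(ℝ, Vec) ∞ (fun q => incl (f q))
  immersive : ∀ p, Function.Injective (mfderiv (𝓡 3) 𝓘(ℝ, Vec) (fun q => incl (f q)) p)
  nondegenerate : ∀ (p : M) (v : TangentSpace (𝓡 3) p),
    (∀ w : TangentSpace (𝓡 3) p, nkMetric (dL f p v) (dL f p w) = 0) → v = 0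
  lagrangian : ∀ (p : M) (v w : TangentSpace (𝓡 3) p), nkMetric (opJ (dL f p v)) (dL f p w) = 0

/-- The ambient covariant derivative `∇̃_v df(Y)` at `p` of a vector field `Y` on `M`, for the
Levi-Civita connection of `g`, left translated to the identity. -/
def covDeriv (f : M → Amb) (Y : (q : M) → TangentSpace (𝓡 3) q) (p : M)
    (v : TangentSpace (𝓡 3) p) : MatPair :=
  ofVec (mfderiv (𝓡 3) 𝓘(ℝ, Vec) (fun q => toVec (dL f q (Y q))) p v) +
    lcConn (dL f p v) (dL f p (Y p))

/-- `n` is the value `h(v, Y_p)` of the second fundamental form: the normal part in the Gauss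
formula `∇̃_v df(Y) = df(w) + n`. -/
def IsSecondFundFormValue (f : M → Amb) (Y : (q : M) → TangentSpace (𝓡 3) q) (p : M)
    (v : TangentSpace (𝓡 3) p) (n : MatPair) : Prop :=
  (∀ w : TangentSpace (𝓡 3) p, nkMetric n (dL f p w) = 0) ∧
    ∃ w : TangentSpace (𝓡 3) p, covDeriv f Y p v = dL f p w + n

variable [IsManifold (𝓡 3) ∞ M]

/-- `Y` is a smooth vector field on the set `U`. -/
def IsSmoothVF (U : Set M) (Y : (q : M) → TangentSpace (𝓡 3) q) : Prop :=
  ContMDiffOn (𝓡 3) (𝓡 3).tangent ∞ (fun q => (⟨q, Y q⟩ : TangentBundle (𝓡 3) M)) U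

/-- `f` is totally geodesic: the second fundamental form vanishes everywhere. -/
def IsTotallyGeodesic (f : M → Amb) : Prop :=
  ∀ (U : Set M) (Y : (q : M) → TangentSpace (𝓡 3) q), IsOpen U → IsSmoothVF U Y →
    ∀ p ∈ U, ∀ v : TangentSpace (𝓡 3) p, IsSecondFundFormValue f Y p v 0

/-- The diagonal entries of `Δ₁ = diag(-1, 1, 1)`. -/
def delta1 : Fin 3 → ℝ := ![-1, 1, 1]

/-- `E` is a smooth `Δ₁`-orthonormal frame on `U` (for the metric induced by `f`) with respect to
which the operators `A`, `B` with `P|_M = A + JB` are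
`A = diag(cos 2θ₁, cos 2θ₂, cos 2θ₃)` and `B = diag(sin 2θ₁, sin 2θ₂, sin 2θ₃)`. -/
structure IsDiagonalizingFrame (f : M → Amb) (U : Set M)
    (E : Fin 3 → (q : M) → TangentSpace (𝓡 3) q) (θ : Fin 3 → M → ℝ) : Prop where
  smooth : ∀ i, IsSmoothVF U (E i)
  orthonormal : ∀ p ∈ U, ∀ i j,
    nkMetric (dL f p (E i p)) (dL f p (E j p)) = if i = j then delta1 i else 0
  diagonal : ∀ p ∈ U, ∃ A B : TangentSpace (𝓡 3) p →ₗ[ℝ] TangentSpace (𝓡 3) p,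
    (∀ v, opP (dL f p v) = dL f p (A v) + opJ (dL f p (B v))) ∧
    ∀ i, A (E i p) = Real.cos (2 * θ i p) • E i p ∧ B (E i p) = Real.sin (2 * θ i p) • E i p

/-- `f` is of diagonalizable type: around each point there is a diagonalizing `Δ₁`-orthonormal
frame. -/
def IsDiagonalizableType (f : M → Amb) : Prop :=
  ∀ p : M, ∃ U : Set M, IsOpen U ∧ p ∈ U ∧
    ∃ (E : Fin 3 → (q : M) → TangentSpace (𝓡 3) q) (θ : Fin 3 → M → ℝ),
      IsDiagonalizingFrame f U E θ

/-- The frame `{E₁, E₃, -E₂}`, with the same orientation as `{E₁, E₂, E₃}`. -/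
def swapFrame (E : Fin 3 → (q : M) → TangentSpace (𝓡 3) q) :
    Fin 3 → (q : M) → TangentSpace (𝓡 3) q :=
  ![E 0, E 2, fun q => -E 1 q]

end Submanifolds

end PseudoNK

end

open PseudoNK

/-!
The proof determines the angle functions pointwise, by differentiating two identities, and then
uses that they take values in a finite set.

Write `ξ = dL f p v` for the left-translated tangent vectors and `κ(ξ, η) = g(ξ, Jη)`. In a chart,
differentiating the Lagrangian condition `κ = 0` and using that covariant derivatives are tangent
gives `κ(∇_ξ η, ζ) + κ(η, ∇_ξ ζ) = 0` on tangent spaces (`∇` being the connection on left-invariant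
fields), and differentiating the condition `κ(∇̃_u df(v), df(w)) = 0` once more and antisymmetrizing
gives `κ(R(ξ, η)ζ, χ) = 0`: the curvature operator preserves tangent spaces. Both computations only
need the Maurer-Cartan equation and the symmetry of second derivatives; they are done abstractly in
`IsGeodesicParam.nearlyKahler` and `IsGeodesicParam.codazzi`, and `tangent_identities` applies them.

At a point, a vector with `Pξ = cos 2θ ξ + sin 2θ Jξ` is of the form `(x w, y w)` with one matrix
`w ∈ 𝔰𝔩(2,ℝ)` and a direction `(x, y)` that depends on `θ`. For a diagonalizing frame the three
matrices `w_i` are orthogonal, and the two identities reduce to `sin (θ₁ + θ₂ + θ₃) = 0` and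
`sin 2(θ_i - θ_j) = 0` (`IsGeodesicFrame.sin_eq_zero`). Hence the numbers `exp (2 i θ_j)` agree up to
sign and have product `1`, and up to a common cube root of unity and the exchange of the two
spacelike vectors they are given by one of the three listed triples (`IsAdmissible.exists_phase`).

Two diagonalizing frames at one point have the same eigenvalues up to that exchange
(`IsPointFrame.swapEq`), and the eigenvalues are continuous with finitely many values, so that they
do not depend on the point of the connected manifold (`exists_swapEq_of_connected`). The isometry
`rho = phi1 * phi2` rotates all doubled angles by `-2π/3` (`isRotation_rho`), and a power of it
removes the cube root of unity.
-/

noncomputable section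

namespace PseudoNK

/-! ### Algebra of `𝔰𝔩(2,ℝ)` and of the ambient Lie algebra -/

theorem ip_eq (a b : Mat2) : ip a b =
    -(1 / 2) * (a 1 1 * b 0 0 - a 0 1 * b 1 0 - a 1 0 * b 0 1 + a 0 0 * b 1 1) := by
  rw [ip, Matrix.adjugate_fin_two, Matrix.trace_fin_two]
  simp only [Matrix.mul_apply, Fin.sum_univ_two, Matrix.of_apply, Matrix.cons_val_zero,
    Matrix.cons_val_one]
  ring

theorem ip_smul_smul (s t : ℝ) (a b : Mat2) : ip (s • a) (t • b) = s * t * ip a b := by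
  simp only [ip_eq, Matrix.smul_apply, smul_eq_mul]; ring

theorem lie_apply (a b : Mat2) (i j : Fin 2) :
    ⁅a, b⁆ i j = a i 0 * b 0 j + a i 1 * b 1 j - (b i 0 * a 0 j + b i 1 * a 1 j) := by
  simp [Ring.lie_def, Matrix.mul_apply, Fin.sum_univ_two]

theorem apply_one_one_of_trace {u : Mat2} (h : u.trace = 0) : u 1 1 = -u 0 0 := by
  rw [Matrix.trace_fin_two] at h; linarith

/-- The double bracket in `𝔰𝔩(2,ℝ)` is the triple vector product of the Lorentzian inner product. -/
theorem lie_lie_eq {u v w : Mat2} (hu : u.trace = 0) (hv : v.trace = 0) (hw : w.trace = 0) :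
    ⁅⁅u, v⁆, w⁆ = (4 * ip v w) • u - (4 * ip u w) • v := by
  have hu := apply_one_one_of_trace hu
  have hv := apply_one_one_of_trace hv
  have hw := apply_one_one_of_trace hw
  ext i j
  fin_cases i <;> fin_cases j <;>
    simp [lie_apply, ip_eq, hu, hv, hw] <;> ring

/-- The triple product `⟨[u, v], w⟩` is a volume form on `𝔰𝔩(2,ℝ)`: its square is a multiple of the
Gram determinant, written here for an orthogonal triple. -/
theorem ip_lie_sq {u v w : Mat2} (hu : u.trace = 0) (hv : v.trace = 0) (hw : w.trace = 0)
    (huv : ip u v = 0) (huw : ip u w = 0) (hvw : ip v w = 0) :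
    ip ⁅u, v⁆ w ^ 2 = -4 * (ip u u * ip v v * ip w w) := by
  have key : ip ⁅u, v⁆ w ^ 2 = -4 * (ip u u * ip v v * ip w w
      + 2 * ip u v * ip v w * ip u w - ip u u * ip v w ^ 2 - ip v v * ip u w ^ 2
      - ip w w * ip u v ^ 2) := by
    have hu := apply_one_one_of_trace hu
    have hv := apply_one_one_of_trace hv
    have hw := apply_one_one_of_trace hw
    simp only [ip_eq, lie_apply, hu, hv, hw]
    ring
  rw [key, huv, huw, hvw]; ring

theorem ip_lie_swap {u v w : Mat2} (hu : u.trace = 0) (hv : v.trace = 0) (hw : w.trace = 0) :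
    ip v ⁅u, w⁆ = -ip ⁅u, v⁆ w := by
  have hu := apply_one_one_of_trace hu
  have hv := apply_one_one_of_trace hv
  have hw := apply_one_one_of_trace hw
  simp only [ip_eq, lie_apply, hu, hv, hw]
  ring

/-- The curvature operator of the Levi-Civita connection on left-invariant vector fields. -/
def curv (ξ η ζ : MatPair) : MatPair :=
  lcConn ξ (lcConn η ζ) - lcConn η (lcConn ξ ζ) - lcConn (br ξ η) ζ

/-- The Kähler form of the ambient space, as the pairing `g(ξ, Jη)`. -/
def kahler (ξ η : MatPair) : ℝ := nkMetric ξ (opJ η)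

/-- The element `(x u, y u)` of the Lie algebra. -/
def tens (e : ℝ × ℝ) (u : Mat2) : MatPair := (e.1 • u, e.2 • u)

/-- The bilinear product on `ℝ × ℝ` through which the connection acts on the elements `tens e u`. -/
def connCoeff (e f : ℝ × ℝ) : ℝ × ℝ :=
  (e.1 * f.1 / 2 - (e.1 * f.2 - e.2 * f.1) / 6, e.2 * f.2 / 2 + (e.1 * f.2 - e.2 * f.1) / 6)

/-- The factor of the metric on the elements `tens e u`. -/
def metricCoeff (e f : ℝ × ℝ) : ℝ :=
  2 / 3 * (e.1 * f.1 + e.2 * f.2) - 1 / 3 * (e.2 * f.1 + e.1 * f.2)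

/-- The almost complex structure on the elements `tens e u`. -/
def complexCoeff (e : ℝ × ℝ) : ℝ × ℝ :=
  (1 / Real.sqrt 3 * (e.1 - 2 * e.2), 1 / Real.sqrt 3 * (2 * e.1 - e.2))

theorem lcConn_tens (e f : ℝ × ℝ) (u v : Mat2) :
    lcConn (tens e u) (tens f v) = tens (connCoeff e f) ⁅u, v⁆ := by
  ext i j <;> simp [lcConn, tens, connCoeff, lie_apply] <;> ring

theorem br_tens (e f : ℝ × ℝ) (u v : Mat2) :
    br (tens e u) (tens f v) = tens (e * f) ⁅u, v⁆ := by
  ext i j <;> simp [br, tens, lie_apply] <;> ring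

theorem opJ_tens (e : ℝ × ℝ) (u : Mat2) : opJ (tens e u) = tens (complexCoeff e) u := by
  ext i j <;> simp [opJ, tens, complexCoeff] <;> ring

theorem nkMetric_tens (e f : ℝ × ℝ) (u v : Mat2) :
    nkMetric (tens e u) (tens f v) = metricCoeff e f * ip u v := by
  simp only [nkMetric, prodMetric, opP, tens, metricCoeff, ip_smul_smul]; ring

theorem curv_tens_self (e f : ℝ × ℝ) {u v : Mat2} (hu : u.trace = 0) (hv : v.trace = 0)
    (huv : ip u v = 0) :
    curv (tens e u) (tens f v) (tens f v) =
      tens (connCoeff f (connCoeff e f) - connCoeff (e * f) f) ((4 * ip v v) • u) := by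
  have h1 : ⁅⁅u, v⁆, v⁆ = (4 * ip v v) • u := by
    rw [lie_lie_eq hu hv hv, huv]; simp
  have h2 : ⁅v, ⁅u, v⁆⁆ = -((4 * ip v v) • u) := by
    rw [← h1, Ring.lie_def v, Ring.lie_def ⁅u, v⁆, neg_sub]
  have h3 : ⁅u, ⁅v, v⁆⁆ = 0 := by simp [Ring.lie_def]
  rw [curv, br_tens, lcConn_tens, lcConn_tens, lcConn_tens, lcConn_tens, lcConn_tens, h1, h2, h3]
  ext i j <;> simp [tens] <;> ring

/-- The direction with angle `θ`: on the elements `tens (unitDir θ) u` the operator `P` agrees with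
`cos 2θ + sin 2θ J`. It has length `√2` for `metricCoeff`. -/
def unitDir (θ : ℝ) : ℝ × ℝ :=
  (√3 * Real.cos θ + Real.sin θ, √3 * Real.cos θ - Real.sin θ)

theorem one_div_sqrt_three : 1 / Real.sqrt 3 = Real.sqrt 3 / 3 := by
  have h : Real.sqrt 3 ^ 2 = 3 := Real.sq_sqrt (by norm_num)
  have : Real.sqrt 3 ≠ 0 := by positivity
  field_simp
  linarith

theorem metricCoeff_unitDir (θ η : ℝ) :
    metricCoeff (unitDir θ) (unitDir η) = 2 * Real.cos (θ - η) := by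
  have h : Real.sqrt 3 ^ 2 = 3 := Real.sq_sqrt (by norm_num)
  rw [Real.cos_sub]
  simp only [metricCoeff, unitDir]
  linear_combination (2 / 3) * Real.cos θ * Real.cos η * h

theorem metricCoeff_complexCoeff_unitDir (θ η : ℝ) :
    metricCoeff (complexCoeff (unitDir θ)) (unitDir η) = 2 * Real.sin (θ - η) := by
  have h : Real.sqrt 3 ^ 2 = 3 := Real.sq_sqrt (by norm_num)
  rw [Real.sin_sub]
  simp only [metricCoeff, complexCoeff, unitDir, one_div_sqrt_three]
  linear_combination (2 / 3) * (Real.sin θ * Real.cos η - Real.cos θ * Real.sin η) * h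

/-- A vector on which `P` agrees with `cos 2θ + sin 2θ J` has both components proportional to one
matrix, in the ratio prescribed by `θ`. -/
theorem exists_eq_tens_unitDir {ξ : MatPair} {θ : ℝ} (hξ : IsTraceFree ξ)
    (h : opP ξ = Real.cos (2 * θ) • ξ + Real.sin (2 * θ) • opJ ξ) :
    ∃ w : Mat2, w.trace = 0 ∧ ξ = tens (unitDir θ) w := by
  have h3 : Real.sqrt 3 ^ 2 = 3 := Real.sq_sqrt (by norm_num)
  have hcs := Real.sin_sq_add_cos_sq θ
  obtain ⟨α, β⟩ := ξ
  obtain ⟨hα, hβ⟩ := hξ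
  simp only at hα hβ
  set C := Real.cos θ
  set S := Real.sin θ
  -- The eigenvalue equation gives two multiples of this proportionality, with factors
  -- `C + √3 S` and `C - √3 S` that do not vanish together.
  have key : ∀ i j, (√3 * C - S) * α i j = (√3 * C + S) * β i j := by
    intro i j
    have e1 := congrFun (congrFun (congrArg Prod.fst h) i) j
    have e2 := congrFun (congrFun (congrArg Prod.snd h) i) j
    simp only [opP, opJ, Real.cos_two_mul, Real.sin_two_mul, one_div_sqrt_three, Prod.smul_mk,
      Prod.mk_add_mk, Matrix.add_apply, Matrix.sub_apply, Matrix.smul_apply, smul_eq_mul] at e1 e2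
    change β i j = (2 * C ^ 2 - 1) * α i j + 2 * S * C * (√3 / 3 * (α i j - 2 * β i j)) at e1
    change α i j = (2 * C ^ 2 - 1) * β i j + 2 * S * C * (√3 / 3 * (2 * α i j - β i j)) at e2
    generalize α i j = a at *
    generalize β i j = b at *
    generalize √3 = r at *
    have f1 : (C + r * S) * ((r * C - S) * a - (r * C + S) * b) = 0 := by
      linear_combination (-r) * e1 + (-2 * S * C * (a - 2 * b) / 3 + S * C * (a - b)) * h3
        - (r * a + r * b) * hcs
    have f2 : (C - r * S) * ((r * C - S) * a - (r * C + S) * b) = 0 := by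
      linear_combination r * e2 + (2 * S * C * (2 * a - b) / 3 - S * C * (a - b)) * h3
        + (r * a + r * b) * hcs
    have f3 : 6 * ((r * C - S) * a - (r * C + S) * b) = 0 := by
      linear_combination (3 * C + r * S) * f1 + (3 * C - r * S) * f2
        - 2 * S ^ 2 * ((r * C - S) * a - (r * C + S) * b) * h3
        - 6 * ((r * C - S) * a - (r * C + S) * b) * hcs
    linarith
  refine ⟨(1 / 6 : ℝ) • ((2 * (√3 * C + S) - (√3 * C - S)) • α
    + (2 * (√3 * C - S) - (√3 * C + S)) • β), ?_, ?_⟩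
  · simp [Matrix.trace_smul, Matrix.trace_add, hα, hβ]
  · ext i j
    · simp only [tens, unitDir, Matrix.smul_apply, Matrix.add_apply, smul_eq_mul]
      linear_combination (2 * (√3 * C - S) - (√3 * C + S)) / 6 * key i j - α i j * hcs
        - C ^ 2 / 3 * α i j * h3
    · simp only [tens, unitDir, Matrix.smul_apply, Matrix.add_apply, smul_eq_mul]
      linear_combination -(2 * (√3 * C + S) - (√3 * C - S)) / 6 * key i j - β i j * hcs
        - C ^ 2 / 3 * β i j * h3

/-! ### The conditions on the angles at a point -/

/-- The pointwise conditions on the frame `ξ` of a tangent space: it is `Δ₁`-orthonormal and spans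
a Lagrangian subspace, `P` acts through the angles `θ`, and the two conditions hold that follow from
differentiating the Lagrangian condition and the vanishing of the second fundamental form. -/
structure IsGeodesicFrame (ξ : Fin 3 → MatPair) (θ : Fin 3 → ℝ) : Prop where
  traceFree : ∀ i, IsTraceFree (ξ i)
  orthonormal : ∀ i j, nkMetric (ξ i) (ξ j) = if i = j then delta1 i else 0
  lagrangian : ∀ i j, nkMetric (opJ (ξ i)) (ξ j) = 0
  eigen : ∀ i, opP (ξ i) = Real.cos (2 * θ i) • ξ i + Real.sin (2 * θ i) • opJ (ξ i)
  nearlyKahler : ∀ i j k, kahler (lcConn (ξ i) (ξ j)) (ξ k) + kahler (ξ j) (lcConn (ξ i) (ξ k)) = 0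
  codazzi : ∀ i j k l, kahler (curv (ξ i) (ξ j) (ξ k)) (ξ l) = 0

/-- The two trigonometric conditions on the angles: `nearlyKahler` on the three frame vectors is a
multiple of the first one, with the volume of the `w i` as a factor, and `codazzi` on
`ξ i, ξ j, ξ j, ξ i` is a non-zero multiple of the second one. -/
theorem IsGeodesicFrame.sin_eq_zero {ξ : Fin 3 → MatPair} {θ : Fin 3 → ℝ}
    (h : IsGeodesicFrame ξ θ) :
    Real.sin (θ 0 + θ 1 + θ 2) = 0 ∧ ∀ i j, Real.sin (2 * (θ i - θ j)) = 0 := by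
  have h3 : Real.sqrt 3 ^ 2 = 3 := Real.sq_sqrt (by norm_num)
  choose w hw hξ using fun i => exists_eq_tens_unitDir (h.traceFree i) (h.eigen i)
  have hnorm : ∀ i, 2 * ip (w i) (w i) = delta1 i := by
    intro i
    have := h.orthonormal i i
    rw [hξ, nkMetric_tens, metricCoeff_unitDir] at this
    simpa using this
  have hne : ∀ i, ip (w i) (w i) ≠ 0 := by
    intro i hi
    have := hnorm i
    rw [hi] at this
    fin_cases i <;> simp [delta1] at this
  have horth : ∀ i j, i ≠ j → ip (w i) (w j) = 0 := by
    intro i j hij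
    have h1 := h.orthonormal i j
    have h2 := h.lagrangian i j
    rw [hξ i, hξ j, nkMetric_tens, metricCoeff_unitDir, if_neg hij] at h1
    rw [hξ i, hξ j, opJ_tens, nkMetric_tens, metricCoeff_complexCoeff_unitDir] at h2
    have h4 := Real.sin_sq_add_cos_sq (θ i - θ j)
    linear_combination Real.cos (θ i - θ j) / 2 * h1 + Real.sin (θ i - θ j) / 2 * h2
      - ip (w i) (w j) * h4
  constructor
  · have h1 := h.nearlyKahler 0 1 2
    have hvol := ip_lie_sq (hw 0) (hw 1) (hw 2) (horth 0 1 (by decide)) (horth 0 2 (by decide))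
      (horth 1 2 (by decide))
    have hvne : ip ⁅w 0, w 1⁆ (w 2) ≠ 0 := by
      intro h0
      rw [h0] at hvol
      have := mul_ne_zero (mul_ne_zero (hne 0) (hne 1)) (hne 2)
      apply this
      linarith
    rw [kahler, kahler, hξ 0, hξ 1, hξ 2, lcConn_tens, lcConn_tens, opJ_tens, opJ_tens,
      nkMetric_tens, nkMetric_tens, ip_lie_swap (hw 0) (hw 1) (hw 2)] at h1
    have h2 : metricCoeff (connCoeff (unitDir (θ 0)) (unitDir (θ 1))) (complexCoeff (unitDir (θ 2)))
        - metricCoeff (unitDir (θ 1))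
          (complexCoeff (connCoeff (unitDir (θ 0)) (unitDir (θ 2)))) = 0 := by
      refine (mul_eq_zero.1 ?_).resolve_left hvne
      linear_combination h1
    rw [Real.sin_add, Real.sin_add, Real.cos_add]
    simp only [metricCoeff, connCoeff, complexCoeff, unitDir, one_div_sqrt_three] at h2
    generalize Real.sin (θ 0) = s0 at *
    generalize Real.sin (θ 1) = s1 at *
    generalize Real.sin (θ 2) = s2 at *
    generalize Real.cos (θ 0) = c0 at *
    generalize Real.cos (θ 1) = c1 at *
    generalize Real.cos (θ 2) = c2 at *
    generalize √3 = r at *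
    have r3 : r ^ 3 = 3 * r := by rw [pow_succ, h3]
    ring_nf at h2
    simp only [r3] at h2
    linear_combination (-r / 2) * h2
      - (s0 * c1 * c2 + c0 * s1 * c2 + c0 * c1 * s2 - s0 * s1 * s2) / 3 * h3
  · intro i j
    by_cases hij : i = j
    · simp [hij]
    have h1 := h.codazzi i j j i
    rw [kahler, hξ i, hξ j, curv_tens_self _ _ (hw i) (hw j) (horth i j hij), opJ_tens] at h1
    rw [nkMetric_tens] at h1
    have h4 : ip ((4 * ip (w j) (w j)) • w i) (w i) ≠ 0 := by
      have := ip_smul_smul (4 * ip (w j) (w j)) 1 (w i) (w i)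
      rw [one_smul] at this
      rw [this]
      exact mul_ne_zero (by simpa using hne j) (hne i)
    have h2 := (mul_eq_zero.1 h1).resolve_right h4
    have hi := Real.sin_sq_add_cos_sq (θ i)
    have hj := Real.sin_sq_add_cos_sq (θ j)
    rw [Real.sin_two_mul, Real.sin_sub, Real.cos_sub]
    simp only [metricCoeff, connCoeff, complexCoeff, unitDir, one_div_sqrt_three, Prod.fst_mul,
      Prod.snd_mul, Prod.fst_sub, Prod.snd_sub] at h2
    generalize Real.sin (θ i) = s0 at *
    generalize Real.sin (θ j) = s1 at *
    generalize Real.cos (θ i) = c0 at *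
    generalize Real.cos (θ j) = c1 at *
    generalize √3 = r at *
    have r4 : r ^ 4 = 9 := by rw [show r ^ 4 = (r ^ 2) ^ 2 by ring, h3]; norm_num
    ring_nf at h2
    simp only [h3, r4] at h2
    linear_combination (-3 / 2) * h2

/-! ### The possible eigenvalues -/

/-- The unit complex number `exp (i t)`; the angle functions enter through `phase (2 θ)`. -/
def phase (t : ℝ) : ℂ := Complex.exp (t * Complex.I)

theorem phase_add (s t : ℝ) : phase (s + t) = phase s * phase t := by
  simp [phase, add_mul, Complex.exp_add]

theorem phase_eq (t : ℝ) : phase t = ⟨Real.cos t, Real.sin t⟩ := by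
  rw [phase, Complex.exp_mul_I, ← Complex.ofReal_cos, ← Complex.ofReal_sin]
  apply Complex.ext <;> simp [Complex.cos_ofReal_re, Complex.sin_ofReal_re]

theorem phase_eq_iff {s t : ℝ} :
    phase s = phase t ↔ Real.cos s = Real.cos t ∧ Real.sin s = Real.sin t := by
  simp [phase_eq]

theorem phase_two_mul_of_sin_eq_zero {t : ℝ} (h : Real.sin t = 0) : phase (2 * t) = 1 := by
  have h1 := Real.sin_sq_add_cos_sq t
  rw [h] at h1
  rw [phase_eq, Real.sin_two_mul, Real.cos_two_mul, h]
  apply Complex.ext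
  · simp only [Complex.one_re]; linarith
  · simp

/-- The possible eigenvalues `exp (2 i θ_j)` of `A + i B`: their product is `1` and they agree up to
sign. -/
def IsAdmissible (z : Fin 3 → ℂ) : Prop :=
  z 0 * z 1 * z 2 = 1 ∧ ∀ i, z i = z 0 ∨ z i = -z 0

theorem IsGeodesicFrame.isAdmissible {ξ : Fin 3 → MatPair} {θ : Fin 3 → ℝ}
    (h : IsGeodesicFrame ξ θ) : IsAdmissible fun i => phase (2 * θ i) := by
  obtain ⟨h1, h2⟩ := h.sin_eq_zero
  constructor
  · have := phase_two_mul_of_sin_eq_zero h1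
    rw [mul_add, mul_add, phase_add, phase_add] at this
    exact this
  · intro i
    have h3 := phase_two_mul_of_sin_eq_zero (h2 i 0)
    have h4 : phase (2 * θ i) = phase (2 * (θ i - θ 0)) * phase (2 * θ 0) := by
      rw [← phase_add]; congr 1; ring
    have h5 : phase (2 * (θ i - θ 0)) ^ 2 = 1 := by
      rw [← h3, sq, ← phase_add]; congr 1; ring
    rcases mul_self_eq_one_iff.1 (sq (phase (2 * (θ i - θ 0))) ▸ h5) with h6 | h6
    · left; simpa [h6] using h4
    · right; simpa [h6] using h4

/-- Equality of triples up to exchanging the last two entries. -/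
def SwapEq (z w : Fin 3 → ℂ) : Prop := z = w ∨ z = w ∘ Equiv.swap 1 2

theorem SwapEq.refl (z : Fin 3 → ℂ) : SwapEq z z := Or.inl rfl

theorem comp_swap_comp_swap (z : Fin 3 → ℂ) : (z ∘ Equiv.swap 1 2) ∘ Equiv.swap 1 2 = z := by
  ext i; simp

theorem SwapEq.trans {x y z : Fin 3 → ℂ} (h : SwapEq x y) (h' : SwapEq y z) : SwapEq x z := by
  rcases h with rfl | rfl
  · exact h'
  · rcases h' with rfl | rfl
    · exact Or.inr rfl
    · exact Or.inl (comp_swap_comp_swap z)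

/-- Admissible triples with the same first entry and the same set of entries agree up to exchanging
the last two entries: the product of the last two signs is determined by the first entry. -/
theorem IsAdmissible.swapEq {z w : Fin 3 → ℂ} (hz : IsAdmissible z) (hw : IsAdmissible w)
    (h0 : z 0 = w 0) (hzw : ∀ i, ∃ j, z i = w j) (hwz : ∀ i, ∃ j, w i = z j) : SwapEq z w := by
  have s0 : (Equiv.swap (1 : Fin 3) 2) 0 = 0 := by decide
  have s1 : (Equiv.swap (1 : Fin 3) 2) 1 = 2 := by decide
  have s2 : (Equiv.swap (1 : Fin 3) 2) 2 = 1 := by decide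
  have ha : w 0 ≠ 0 := by
    intro h
    have := hw.1
    simp [h] at this
  have hb : w 0 ≠ -w 0 := fun h => ha (self_eq_neg.1 h)
  have hzp := hz.1
  have hwp := hw.1
  have ha3 : w 0 * w 0 * w 0 ≠ -(w 0 * w 0 * w 0) :=
    fun h => mul_ne_zero (mul_ne_zero ha ha) ha (self_eq_neg.1 h)
  have z1 := hz.2 1
  have z2 := hz.2 2
  have w1 := hw.2 1
  have w2 := hw.2 2
  have e1 := hzw 1
  have e2 := hwz 1
  simp only [Fin.exists_fin_succ, SwapEq, funext_iff, Fin.forall_fin_succ, Function.comp] at *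
  simp [s0, s1, s2] at *
  rw [h0] at *
  rcases z1 with z1 | z1 <;> rcases z2 with z2 | z2 <;> rcases w1 with w1 | w1 <;>
    rcases w2 with w2 | w2 <;> simp_all <;> norm_num at hwp

/-- Admissible triples, up to a common cube root of unity and the exchange of the last two entries.
-/
theorem IsAdmissible.exists_phase {z : Fin 3 → ℂ} (hz : IsAdmissible z) :
    ∃ (r : ℕ) (c : Fin 3 → ℝ),
      (c = ![4 * Real.pi / 3, 4 * Real.pi / 3, 4 * Real.pi / 3] ∨
          c = ![0, Real.pi, Real.pi] ∨ c = ![Real.pi, Real.pi, 0]) ∧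
      SwapEq z fun i => phase (r * (2 * Real.pi / 3) + c i) := by
  have hprim : IsPrimitiveRoot (phase (2 * Real.pi / 3)) 3 := by
    convert Complex.isPrimitiveRoot_exp 3 (by norm_num) using 1
    rw [phase]; congr 1; push_cast; ring
  have hpow : ∀ r : ℕ, phase (2 * Real.pi / 3) ^ r = phase (r * (2 * Real.pi / 3)) := by
    intro r
    rw [phase, phase, ← Complex.exp_nat_mul]; congr 1; push_cast; ring
  have hroot : ∀ x : ℂ, x * x * x = 1 → ∃ r : ℕ, x = phase (r * (2 * Real.pi / 3)) := by
    intro x hx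
    obtain ⟨r, -, hr⟩ := hprim.eq_pow_of_pow_eq_one (ξ := x) (by rw [← hx]; ring)
    exact ⟨r, by rw [← hr, hpow]⟩
  have hpi : phase Real.pi = -1 := by simp [phase]
  have h0 : phase 0 = 1 := by simp [phase]
  have h43 : phase (2 * Real.pi / 3) * phase (4 * Real.pi / 3) = 1 := by
    rw [← phase_add, show 2 * Real.pi / 3 + 4 * Real.pi / 3 = 2 * Real.pi by ring]
    simp [phase, Complex.exp_two_pi_mul_I]
  have hsucc : ∀ r : ℕ, phase ((r + 1 : ℕ) * (2 * Real.pi / 3)) * phase (4 * Real.pi / 3)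
      = phase (r * (2 * Real.pi / 3)) := by
    intro r
    rw [← hpow, pow_succ, mul_assoc, h43, mul_one, hpow]
  have s0 : (Equiv.swap (1 : Fin 3) 2) 0 = 0 := by decide
  have hp := hz.1
  rcases hz.2 1 with h1 | h1 <;> rcases hz.2 2 with h2 | h2 <;> rw [h1, h2] at hp
  · obtain ⟨r, hr⟩ := hroot (z 0) hp
    -- The listed triple is `4π/3` and not `0`, which shifts the exponent by one.
    refine ⟨r + 1, _, Or.inl rfl, Or.inl ?_⟩
    ext i
    fin_cases i <;> simp only [phase_add] <;> simp [h1, h2, hr, -Nat.cast_add, hsucc]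
  · obtain ⟨r, hr⟩ := hroot (-z 0) (by linear_combination hp)
    have hr : z 0 = -phase (r * (2 * Real.pi / 3)) := by rw [← hr, neg_neg]
    refine ⟨r, _, Or.inr (Or.inr rfl), Or.inl ?_⟩
    ext i
    fin_cases i <;> simp [phase_add, h1, h2, hr, hpi]
  · obtain ⟨r, hr⟩ := hroot (-z 0) (by linear_combination hp)
    have hr : z 0 = -phase (r * (2 * Real.pi / 3)) := by rw [← hr, neg_neg]
    refine ⟨r, _, Or.inr (Or.inr rfl), Or.inr ?_⟩
    ext i
    fin_cases i <;> simp [phase_add, h1, h2, hr, hpi, h0, s0]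
  · obtain ⟨r, hr⟩ := hroot (z 0) (by linear_combination hp)
    refine ⟨r, _, Or.inr (Or.inl rfl), Or.inl ?_⟩
    ext i
    fin_cases i <;> simp [phase_add, h1, h2, hr, hpi]

/-! ### Isometries that rotate the angle functions -/

theorem leftTr_inv_leftTr (x : Amb) (ξ : MatPair) : leftTr x⁻¹ (leftTr x ξ) = ξ := by
  have h : ∀ (a : SL(2, ℝ)) (α : Mat2), ((a⁻¹ : SL(2, ℝ)) : Mat2) * ((a : Mat2) * α) = α := by
    intro a α
    rw [← Matrix.mul_assoc, ← Matrix.SpecialLinearGroup.coe_mul, inv_mul_cancel,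
      Matrix.SpecialLinearGroup.coe_one, Matrix.one_mul]
  exact Prod.ext (h x.1 ξ.1) (h x.2 ξ.2)

theorem leftTr_leftTr_inv (x : Amb) (ξ : MatPair) : leftTr x (leftTr x⁻¹ ξ) = ξ := by
  have := leftTr_inv_leftTr x⁻¹ ξ
  rwa [inv_inv] at this

theorem leftTr_smul (x : Amb) (s : ℝ) (ξ : MatPair) : leftTr x (s • ξ) = s • leftTr x ξ :=
  Prod.ext (Matrix.mul_smul _ _ _) (Matrix.mul_smul _ _ _)

theorem ofVec_toVec (ξ : MatPair) : ofVec (toVec ξ) = ξ := rfl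

theorem toVec_ofVec (x : Vec) : toVec (ofVec x) = x := rfl

/-- The diffeomorphism `φ` is the restriction of a smooth map `Φ`, and its left-translated
differential `K` preserves `g` and `J` and turns `P` by the angle `t` with respect to `J`. Composing
a Lagrangian immersion with `φ` adds `t` to the doubled angle functions. -/
structure IsRotation (φ : Equiv.Perm Amb) (t : ℝ) (Φ : Vec → Vec)
    (K : Amb → MatPair →ₗ[ℝ] MatPair) : Prop where
  contDiff : ContDiff ℝ ∞ Φ
  apply_incl : ∀ x, Φ (incl x) = incl (φ x)
  fderiv_apply : ∀ x ξ, IsTraceFree ξ →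
    fderiv ℝ Φ (incl x) (toVec (leftTr x ξ)) = toVec (leftTr (φ x) (K x ξ))
  traceFree : ∀ x ξ, IsTraceFree ξ → IsTraceFree (K x ξ)
  metric : ∀ x ξ η, nkMetric (K x ξ) (K x η) = nkMetric ξ η
  complex : ∀ x ξ, K x (opJ ξ) = opJ (K x ξ)
  product : ∀ x ξ, opP (K x ξ) = Real.cos t • K x (opP ξ) + Real.sin t • opJ (K x (opP ξ))

theorem opJ_add (ξ η : MatPair) : opJ (ξ + η) = opJ ξ + opJ η := by
  ext i j <;> simp [opJ] <;> ring

theorem opJ_smul (s : ℝ) (ξ : MatPair) : opJ (s • ξ) = s • opJ ξ := by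
  ext i j <;> simp [opJ] <;> ring

theorem opJ_opJ (ξ : MatPair) : opJ (opJ ξ) = -ξ := by
  have h3 : Real.sqrt 3 ^ 2 = 3 := Real.sq_sqrt (by norm_num)
  simp only [opJ, one_div_sqrt_three]
  ext i j
  · simp
    linear_combination (-1 / 3) * ξ.1 i j * h3
  · simp
    linear_combination (-1 / 3) * ξ.2 i j * h3

theorem IsRotation.one : IsRotation 1 0 id fun _ => LinearMap.id where
  contDiff := contDiff_id
  apply_incl _ := rfl
  fderiv_apply _ _ _ := by simp
  traceFree _ _ h := h
  metric _ _ _ := rfl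
  complex _ _ := rfl
  product _ _ := by simp

theorem IsRotation.mul {φ ψ : Equiv.Perm Amb} {s t : ℝ} {Φ Ψ : Vec → Vec}
    {K L : Amb → MatPair →ₗ[ℝ] MatPair} (hφ : IsRotation φ s Φ K) (hψ : IsRotation ψ t Ψ L) :
    IsRotation (φ * ψ) (s + t) (Φ ∘ Ψ) fun x => K (ψ x) ∘ₗ L x where
  contDiff := hφ.contDiff.comp hψ.contDiff
  apply_incl x := by simp [hψ.apply_incl, hφ.apply_incl]
  fderiv_apply x ξ hξ := by
    rw [fderiv_comp _ (hφ.contDiff.differentiable (by simp) _)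
      (hψ.contDiff.differentiable (by simp) _)]
    simp [hψ.fderiv_apply x ξ hξ, hψ.apply_incl, hφ.fderiv_apply _ _ (hψ.traceFree x ξ hξ)]
  traceFree x ξ hξ := hφ.traceFree _ _ (hψ.traceFree x ξ hξ)
  metric x ξ η := by simp [hφ.metric, hψ.metric]
  complex x ξ := by simp [hφ.complex, hψ.complex]
  product x ξ := by
    simp only [LinearMap.comp_apply, hφ.product, hψ.product, map_add, map_smul, hφ.complex, opJ_add,
      opJ_smul, opJ_opJ, Real.cos_add, Real.sin_add]
    module

theorem IsRotation.isAmbIsometry {φ : Equiv.Perm Amb} {t : ℝ} {Φ : Vec → Vec}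
    {K : Amb → MatPair →ₗ[ℝ] MatPair} (h : IsRotation φ t Φ K) : IsAmbIsometry φ := by
  refine ⟨Φ, h.contDiff, h.apply_incl, fun x ξ η hξ hη => ?_⟩
  rw [h.fderiv_apply x ξ hξ, h.fderiv_apply x η hη, ofVec_toVec, ofVec_toVec, leftTr_inv_leftTr,
    leftTr_inv_leftTr, h.metric]

/-- Conjugation by `a`, as a linear map. -/
def conjMap (a : SL(2, ℝ)) : Mat2 →ₗ[ℝ] Mat2 :=
  LinearMap.mulRight ℝ ((a⁻¹ : SL(2, ℝ)) : Mat2) ∘ₗ LinearMap.mulLeft ℝ (a : Mat2)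

theorem conjMap_apply (a : SL(2, ℝ)) (α : Mat2) :
    conjMap a α = (a : Mat2) * α * ((a⁻¹ : SL(2, ℝ)) : Mat2) := rfl

theorem coe_inv_mul_coe (a : SL(2, ℝ)) : ((a⁻¹ : SL(2, ℝ)) : Mat2) * (a : Mat2) = 1 := by
  rw [← Matrix.SpecialLinearGroup.coe_mul, inv_mul_cancel, Matrix.SpecialLinearGroup.coe_one]

theorem trace_conjMap (a : SL(2, ℝ)) (α : Mat2) : (conjMap a α).trace = α.trace := by
  rw [conjMap_apply, Matrix.trace_mul_comm, ← Matrix.mul_assoc, coe_inv_mul_coe, Matrix.one_mul]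

theorem ip_conjMap (a : SL(2, ℝ)) (α β : Mat2) : ip (conjMap a α) (conjMap a β) = ip α β := by
  have hr : ∀ γ δ : Mat2, ∀ b : SL(2, ℝ), ip (γ * (b : Mat2)) (δ * (b : Mat2)) = ip γ δ := by
    intro γ δ b
    have h : (b : Mat2) * (b : Mat2).adjugate = 1 := by
      rw [Matrix.mul_adjugate, b.det_coe, one_smul]
    unfold ip
    rw [Matrix.adjugate_mul_distrib, Matrix.mul_assoc, Matrix.trace_mul_comm, Matrix.mul_assoc,
      Matrix.mul_assoc, h, Matrix.mul_one]
  rw [conjMap_apply, conjMap_apply, hr, ip_left_invariant]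

theorem adjugate_add_fin_two (a b : Mat2) : (a + b).adjugate = a.adjugate + b.adjugate := by
  simp only [Matrix.adjugate_fin_two]
  ext i j
  fin_cases i <;> fin_cases j <;> simp <;> ring

theorem adjugate_smul_fin_two (s : ℝ) (a : Mat2) : (s • a).adjugate = s • a.adjugate := by
  simp [Matrix.adjugate_smul]

theorem adjugate_of_trace {α : Mat2} (h : α.trace = 0) : α.adjugate = -α := by
  have := apply_one_one_of_trace h
  rw [Matrix.adjugate_fin_two]
  ext i j
  fin_cases i <;> fin_cases j <;> simp [this]

/-- The directional derivative of a quadratic map is read off from its expansion. -/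
theorem fderiv_apply_of_expansion {F : Type*} [NormedAddCommGroup F] [NormedSpace ℝ F]
    {Φ : Vec → F} {x v : Vec} {w q : F} (hΦ : DifferentiableAt ℝ Φ x)
    (h : ∀ t : ℝ, Φ (x + t • v) = Φ x + t • w + t ^ 2 • q) : fderiv ℝ Φ x v = w := by
  rw [← hΦ.lineDeriv_eq_fderiv]
  refine HasLineDerivAt.lineDeriv ?_
  rw [HasLineDerivAt]
  simp only [h]
  have h1 : HasDerivAt (fun t : ℝ => t • w) w 0 := by
    simpa using (hasDerivAt_id (0 : ℝ)).smul_const w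
  have h2 : HasDerivAt (fun t : ℝ => t ^ 2 • q) 0 0 := by
    simpa using (hasDerivAt_pow 2 (0 : ℝ)).smul_const q
  exact (((hasDerivAt_const (0 : ℝ) (Φ x)).add h1).add h2).congr_deriv (by simp)

/-- The product of the two generators, `(p, q) ↦ (q p⁻¹, p⁻¹)`. -/
def rho : Equiv.Perm Amb := phi1 * phi2

theorem rho_apply (x : Amb) : rho x = (x.2 * x.1⁻¹, x.1⁻¹) := rfl

/-- Polynomial extension of `rho` to `ℝ⁸`: the inverse is replaced by the adjugate. -/
def rhoExt (x : Vec) : Vec :=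
  toVec ((ofVec x).2 * (ofVec x).1.adjugate, (ofVec x).1.adjugate)

/-- The left-translated differential of `rho`. -/
def rhoDiff (x : Amb) : MatPair →ₗ[ℝ] MatPair :=
  LinearMap.prodMap (conjMap x.1) (conjMap x.1) ∘ₗ
    LinearMap.prod (LinearMap.snd ℝ Mat2 Mat2 - LinearMap.fst ℝ Mat2 Mat2)
      (-LinearMap.fst ℝ Mat2 Mat2)

theorem rhoDiff_apply (x : Amb) (ξ : MatPair) :
    rhoDiff x ξ = (conjMap x.1 (ξ.2 - ξ.1), conjMap x.1 (-ξ.1)) := rfl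

theorem contDiff_rhoExt : ContDiff ℝ ∞ rhoExt := by
  unfold rhoExt toVec ofVec
  simp only [Matrix.adjugate_fin_two, Matrix.mul_apply, Fin.sum_univ_two, Matrix.of_apply]
  refine ContDiff.prodMk (contDiff_pi.2 fun i => contDiff_pi.2 fun j => ?_)
    (contDiff_pi.2 fun i => contDiff_pi.2 fun j => ?_)
  · fin_cases i <;> fin_cases j <;> simp <;> fun_prop
  · fin_cases i <;> fin_cases j <;> simp <;> fun_prop

/-- In the coordinates `(x, y)` of `tens`, the differential of `rho` is the rotation of order three
`(x, y) ↦ (y - x, -x)`. -/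
theorem isRotation_rho : IsRotation rho (-(2 * Real.pi / 3)) rhoExt rhoDiff where
  contDiff := contDiff_rhoExt
  apply_incl x := by
    rw [rho_apply, rhoExt, incl, incl, ofVec_toVec]
    congr 1
  fderiv_apply x ξ hξ := by
    obtain ⟨a, b⟩ := x
    obtain ⟨α, β⟩ := ξ
    have hα : α.trace = 0 := hξ.1
    apply fderiv_apply_of_expansion (contDiff_rhoExt.differentiable (by simp) _)
      (q := toVec ((b : Mat2) * β * ((a : Mat2) * α).adjugate, 0))
    intro t
    have e1 : incl (a, b) + t • toVec (leftTr (a, b) (α, β)) =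
      toVec ((a : Mat2) + t • ((a : Mat2) * α), (b : Mat2) + t • ((b : Mat2) * β)) := rfl
    have e2 : toVec (leftTr (rho (a, b)) (rhoDiff (a, b) (α, β))) =
        toVec ((b : Mat2) * β * (a : Mat2).adjugate + b * ((a : Mat2) * α).adjugate,
          ((a : Mat2) * α).adjugate) := by
      rw [rho_apply, rhoDiff_apply, Matrix.adjugate_mul_distrib, adjugate_of_trace hα,
        ← Matrix.SpecialLinearGroup.coe_inv]
      simp only [leftTr, conjMap_apply, Matrix.SpecialLinearGroup.coe_mul]
      congr 2
      · simp only [← Matrix.mul_assoc, Matrix.mul_assoc (b : Mat2) _ (a : Mat2), coe_inv_mul_coe]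
        noncomm_ring
      · simp only [← Matrix.mul_assoc, coe_inv_mul_coe]
        noncomm_ring
    rw [e1, e2]
    simp only [rhoExt, ofVec_toVec, incl, adjugate_add_fin_two, adjugate_smul_fin_two]
    ext i j
    · simp [toVec, Matrix.add_mul, Matrix.mul_add]
      ring
    · simp [toVec]
  traceFree x ξ hξ := by
    obtain ⟨h1, h2⟩ := hξ
    simp [rhoDiff_apply, IsTraceFree, trace_conjMap, h1, h2, Matrix.trace_sub, Matrix.trace_neg]
  metric x ξ η := by
    simp only [rhoDiff_apply, nkMetric, prodMetric, opP, ip_conjMap]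
    simp only [ip_eq, Matrix.sub_apply, Matrix.neg_apply]
    ring
  complex x ξ := by
    simp only [rhoDiff_apply, opJ, ← map_smul, ← map_sub, Prod.smul_mk]
    congr 2
    · module
    · module
  product x ξ := by
    have h3 : Real.sqrt 3 ^ 2 = 3 := Real.sq_sqrt (by norm_num)
    have hc : Real.cos (2 * Real.pi / 3) = -(1 / 2) := by
      rw [show 2 * Real.pi / 3 = Real.pi - Real.pi / 3 by ring, Real.cos_pi_sub,
        Real.cos_pi_div_three]
    have hs : Real.sin (2 * Real.pi / 3) = √3 / 2 := by
      rw [show 2 * Real.pi / 3 = Real.pi - Real.pi / 3 by ring, Real.sin_pi_sub,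
        Real.sin_pi_div_three]
    rw [Real.cos_neg, Real.sin_neg, hc, hs]
    simp only [rhoDiff_apply, opJ, opP, one_div_sqrt_three, map_sub, map_neg]
    ext i j
    · simp
      linear_combination (1 / 6) * (conjMap x.1 ξ.1 i j + conjMap x.1 ξ.2 i j) * h3
    · simp
      linear_combination (1 / 6) * (2 * conjMap x.1 ξ.1 i j - conjMap x.1 ξ.2 i j) * h3

theorem exists_isRotation_rho_pow (r : ℕ) :
    ∃ Φ K, IsRotation (rho ^ r) (-(r * (2 * Real.pi / 3))) Φ K := by
  induction r with
  | zero => exact ⟨_, _, by simpa using IsRotation.one⟩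
  | succ r ih =>
    obtain ⟨Φ, K, h⟩ := ih
    have := h.mul isRotation_rho
    rw [← pow_succ, show -(r * (2 * Real.pi / 3)) + -(2 * Real.pi / 3) =
      -((r + 1 : ℕ) * (2 * Real.pi / 3)) by push_cast; ring] at this
    exact ⟨_, _, this⟩

/-! ### Left-translated differentials and rotations of immersions -/

section Immersions

variable {M : Type*} [TopologicalSpace M] [ChartedSpace (EuclideanSpace ℝ (Fin 3)) M]

theorem mfderiv_incl_eq (f : M → Amb) (p : M) (v : TangentSpace (𝓡 3) p) :
    mfderiv (𝓡 3) 𝓘(ℝ, Vec) (fun q => incl (f q)) p v = toVec (leftTr (f p) (dL f p v)) := by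
  rw [dL, leftTr_leftTr_inv]; rfl

/-- The determinants of a pair of matrices. -/
def detPair (x : Vec) : ℝ × ℝ := ((ofVec x).1.det, (ofVec x).2.det)

theorem contDiff_detPair : ContDiff ℝ ∞ detPair := by
  unfold detPair ofVec
  simp only [Matrix.det_fin_two, Matrix.of_apply]
  fun_prop

theorem fderiv_detPair (x v : Vec) : fderiv ℝ detPair x v =
    (((ofVec x).1.adjugate * (ofVec v).1).trace, ((ofVec x).2.adjugate * (ofVec v).2).trace) := by
  apply fderiv_apply_of_expansion (contDiff_detPair.differentiable (by simp) _)
    (q := ((ofVec v).1.det, (ofVec v).2.det))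
  intro t
  ext <;>
  · simp only [detPair, ofVec, Matrix.det_fin_two, Matrix.adjugate_fin_two, Matrix.trace_fin_two,
      Matrix.mul_apply, Fin.sum_univ_two]
    simp
    ring

theorem detPair_incl (x : Amb) : detPair (incl x) = (1, 1) := by
  rw [detPair, incl, ofVec_toVec]
  exact Prod.ext x.1.det_coe x.2.det_coe

/-- Left-translated tangent vectors lie in the Lie algebra, since the determinants are constant. -/
theorem isTraceFree_dL {f : M → Amb} {p : M}
    (hf : MDifferentiableAt (𝓡 3) 𝓘(ℝ, Vec) (fun q => incl (f q)) p) (v : TangentSpace (𝓡 3) p) :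
    IsTraceFree (dL f p v) := by
  have h1 : mfderiv (𝓡 3) 𝓘(ℝ, ℝ × ℝ) (detPair ∘ fun q => incl (f q)) p = 0 := by
    have : (detPair ∘ fun q => incl (f q)) = fun _ => ((1 : ℝ), (1 : ℝ)) :=
      funext fun q => detPair_incl (f q)
    rw [this, mfderiv_const]
  have hd : MDifferentiableAt 𝓘(ℝ, Vec) 𝓘(ℝ, ℝ × ℝ) detPair (incl (f p)) :=
    (contDiff_detPair.differentiable (by simp) _).mdifferentiableAt
  rw [mfderiv_comp p hd hf, mfderiv_eq_fderiv] at h1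
  have h2 := congrArg (fun L : TangentSpace (𝓡 3) p →L[ℝ] ℝ × ℝ => L v) h1
  have h3 : fderiv ℝ detPair (incl (f p))
      (mfderiv (𝓡 3) 𝓘(ℝ, Vec) (fun q => incl (f q)) p v) = 0 := h2
  have h4 := (fderiv_detPair _ _).symm.trans h3
  exact ⟨congrArg Prod.fst h4, congrArg Prod.snd h4⟩

theorem IsRotation.dL_comp {φ : Equiv.Perm Amb} {t : ℝ} {Φ : Vec → Vec}
    {K : Amb → MatPair →ₗ[ℝ] MatPair} (h : IsRotation φ t Φ K) {f : M → Amb} {p : M}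
    (hf : MDifferentiableAt (𝓡 3) 𝓘(ℝ, Vec) (fun q => incl (f q)) p) (v : TangentSpace (𝓡 3) p) :
    dL (fun q => φ (f q)) p v = K (f p) (dL f p v) := by
  have hd : MDifferentiableAt 𝓘(ℝ, Vec) 𝓘(ℝ, Vec) Φ (incl (f p)) :=
    (h.contDiff.differentiable (by simp) _).mdifferentiableAt
  have h1 : mfderiv (𝓡 3) 𝓘(ℝ, Vec) (fun q => incl (φ (f q))) p v =
      fderiv ℝ Φ (incl (f p)) (mfderiv (𝓡 3) 𝓘(ℝ, Vec) (fun q => incl (f q)) p v) := by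
    have h2 : (fun q => incl (φ (f q))) = Φ ∘ fun q => incl (f q) :=
      funext fun q => (h.apply_incl (f q)).symm
    rw [h2, mfderiv_comp p hd hf, mfderiv_eq_fderiv]
    rfl
  rw [dL, h1, mfderiv_incl_eq, h.fderiv_apply _ _ (isTraceFree_dL hf v), ofVec_toVec,
    leftTr_inv_leftTr]

theorem dL_add (f : M → Amb) (p : M) (v w : TangentSpace (𝓡 3) p) :
    dL f p (v + w) = dL f p v + dL f p w := by
  rw [dL, map_add]
  exact Prod.ext (Matrix.mul_add _ _ _) (Matrix.mul_add _ _ _)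

theorem dL_smul (f : M → Amb) (p : M) (s : ℝ) (v : TangentSpace (𝓡 3) p) :
    dL f p (s • v) = s • dL f p v := by
  rw [dL, map_smul]
  exact leftTr_smul _ s (ofVec (mfderiv (𝓡 3) 𝓘(ℝ, Vec) (fun q => incl (f q)) p v))

theorem IsLagrangianImmersion.mdifferentiableAt {f : M → Amb} (hf : IsLagrangianImmersion f)
    (p : M) : MDifferentiableAt (𝓡 3) 𝓘(ℝ, Vec) (fun q => incl (f q)) p :=
  hf.smooth.mdifferentiable (by simp) p

theorem IsRotation.isLagrangianImmersion {φ : Equiv.Perm Amb} {t : ℝ} {Φ : Vec → Vec}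
    {K : Amb → MatPair →ₗ[ℝ] MatPair} (h : IsRotation φ t Φ K) {f : M → Amb}
    (hf : IsLagrangianImmersion f) : IsLagrangianImmersion fun p => φ (f p) := by
  have hK : ∀ p v, dL (fun q => φ (f q)) p v = K (f p) (dL f p v) :=
    fun p v => h.dL_comp (hf.mdifferentiableAt p) v
  have hnd : ∀ (p : M) (v : TangentSpace (𝓡 3) p), (∀ w : TangentSpace (𝓡 3) p,
      nkMetric (dL (fun q => φ (f q)) p v) (dL (fun q => φ (f q)) p w) = 0) → v = 0 := by
    intro p v hv
    refine hf.nondegenerate p v fun w => ?_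
    rw [← h.metric (f p), ← hK, ← hK, hv]
  refine ⟨?_, ?_, hnd, ?_⟩
  · have h2 : (fun q => incl (φ (f q))) = Φ ∘ fun q => incl (f q) :=
      funext fun q => (h.apply_incl (f q)).symm
    rw [h2]
    exact h.contDiff.contMDiff.comp hf.smooth
  · intro p
    rw [injective_iff_map_eq_zero]
    intro v hv
    refine hnd p v fun w => ?_
    have : dL (fun q => φ (f q)) p v = 0 := by
      rw [dL, hv]
      exact Prod.ext (Matrix.mul_zero _) (Matrix.mul_zero _)
    rw [this]
    simp [nkMetric, prodMetric, opP, ip]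
  · intro p v w
    rw [hK, hK, ← h.complex, h.metric, hf.lagrangian]

variable [IsManifold (𝓡 3) ∞ M]

/-- A rotation by `t` adds `t` to the doubled angles, and these matter only modulo `2π`. -/
theorem IsRotation.isDiagonalizingFrame {φ : Equiv.Perm Amb} {t : ℝ} {Φ : Vec → Vec}
    {K : Amb → MatPair →ₗ[ℝ] MatPair} (h : IsRotation φ t Φ K) {f : M → Amb}
    (hf : IsLagrangianImmersion f) {U : Set M} {E : Fin 3 → (q : M) → TangentSpace (𝓡 3) q}
    {θ θ' : Fin 3 → M → ℝ} (hE : IsDiagonalizingFrame f U E θ)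
    (hθ : ∀ p ∈ U, ∀ i, phase (2 * θ' i p) = phase (t + 2 * θ i p)) :
    IsDiagonalizingFrame (fun p => φ (f p)) U E θ' := by
  have hK : ∀ p v, dL (fun q => φ (f q)) p v = K (f p) (dL f p v) :=
    fun p v => h.dL_comp (hf.mdifferentiableAt p) v
  refine ⟨hE.smooth, fun p hp i j => ?_, fun p hp => ?_⟩
  · rw [hK, hK, h.metric, hE.orthonormal p hp]
  · obtain ⟨A, B, hAB, hE'⟩ := hE.diagonal p hp
    refine ⟨Real.cos t • A - Real.sin t • B, Real.sin t • A + Real.cos t • B, fun v => ?_,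
      fun i => ?_⟩
    · have hsub : ∀ v w : TangentSpace (𝓡 3) p, dL f p (v - w) = dL f p v - dL f p w := by
        intro v w
        rw [eq_sub_iff_add_eq, ← dL_add, sub_add_cancel]
      simp only [hK, h.product, hAB, LinearMap.sub_apply, LinearMap.add_apply, LinearMap.smul_apply,
        hsub, dL_add, dL_smul, map_add, map_sub, map_smul, h.complex, opJ_add, opJ_smul, opJ_opJ]
      module
    · obtain ⟨h1, h2⟩ := phase_eq_iff.1 (hθ p hp i)
      rw [h1, h2, Real.cos_add, Real.sin_add]
      simp only [LinearMap.sub_apply, LinearMap.add_apply, LinearMap.smul_apply, (hE' i).1,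
        (hE' i).2]
      constructor <;> module

theorem IsDiagonalizingFrame.swap {f : M → Amb} {U : Set M}
    {E : Fin 3 → (q : M) → TangentSpace (𝓡 3) q} {θ : Fin 3 → M → ℝ}
    (hE : IsDiagonalizingFrame f U E θ) :
    IsDiagonalizingFrame f U (swapFrame E) fun i => θ (Equiv.swap 1 2 i) := by
  have s0 : (Equiv.swap (1 : Fin 3) 2) 0 = 0 := by decide
  have s1 : (Equiv.swap (1 : Fin 3) 2) 1 = 2 := by decide
  have s2 : (Equiv.swap (1 : Fin 3) 2) 2 = 1 := by decide
  have hneg : ∀ (p : M) (v : TangentSpace (𝓡 3) p), dL f p (-v) = (-1 : ℝ) • dL f p v := by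
    intro p v
    rw [← dL_smul, neg_one_smul]
  refine ⟨fun i => ?_, fun p hp i j => ?_, fun p hp => ?_⟩
  · fin_cases i
    · exact hE.smooth 0
    · exact hE.smooth 2
    · exact ContMDiffOn.neg_section (hE.smooth 1)
  · have h := fun i j => hE.orthonormal p hp i j
    have hl : ∀ ξ η, nkMetric ((-1 : ℝ) • ξ) η = -nkMetric ξ η := by
      intro ξ η
      simp only [nkMetric, prodMetric, opP, ip_eq, Prod.smul_fst, Prod.smul_snd,
        Matrix.smul_apply, smul_eq_mul]
      ring
    have hr : ∀ ξ η, nkMetric ξ ((-1 : ℝ) • η) = -nkMetric ξ η := by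
      intro ξ η
      simp only [nkMetric, prodMetric, opP, ip_eq, Prod.smul_fst, Prod.smul_snd,
        Matrix.smul_apply, smul_eq_mul]
      ring
    have e0 : dL f p (swapFrame E 0 p) = dL f p (E 0 p) := rfl
    have e1 : dL f p (swapFrame E 1 p) = dL f p (E 2 p) := rfl
    have e2 : dL f p (swapFrame E 2 p) = (-1 : ℝ) • dL f p (E 1 p) := hneg p (E 1 p)
    match i, j with
    | 0, 0 => rw [e0, h]
    | 0, 1 => rw [e0, e1, h]; rfl
    | 0, 2 => rw [e0, e2, hr, h]; simp
    | 1, 0 => rw [e0, e1, h]; rfl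
    | 1, 1 => rw [e1, h]; rfl
    | 1, 2 => rw [e1, e2, hr, h]; simp
    | 2, 0 => rw [e0, e2, hl, h]; simp
    | 2, 1 => rw [e1, e2, hl, h]; simp
    | 2, 2 => rw [e2, hl, hr, h, neg_neg]; rfl
  · obtain ⟨A, B, hAB, h⟩ := hE.diagonal p hp
    refine ⟨A, B, hAB, fun i => ?_⟩
    match i with
    | 0 => rw [s0]; exact h 0
    | 1 => rw [s1]; exact h 2
    | 2 =>
      rw [s2]
      change A (-E 1 p) = _ • (-E 1 p) ∧ B (-E 1 p) = _ • (-E 1 p)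
      rw [map_neg, map_neg, (h 1).1, (h 1).2, smul_neg, smul_neg]
      exact ⟨rfl, rfl⟩

end Immersions

/-! ### Differentiating the Lagrangian and totally geodesic conditions -/

section Calculus

variable {H V : Type*} [NormedAddCommGroup H] [NormedSpace ℝ H] [NormedAddCommGroup V]
  [NormedSpace ℝ V]

/-- Data of a totally geodesic Lagrangian parametrization in terms of its left-translated
differential `X`, for an abstract connection `L`, bracket `br` and Kähler form `κ`: the Lagrangian
condition, the Maurer-Cartan equation, and tangency of covariant derivatives. -/
structure IsGeodesicParam (κ : V →L[ℝ] V →L[ℝ] ℝ) (L br : V →L[ℝ] V →L[ℝ] V) (Ω : Set H)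
    (X : H → H →L[ℝ] V) : Prop where
  isOpen : IsOpen Ω
  contDiffOn : ContDiffOn ℝ 2 X Ω
  lagrangian : ∀ y ∈ Ω, ∀ u v, κ (X y u) (X y v) = 0
  maurerCartan : ∀ y ∈ Ω, ∀ u v, fderiv ℝ X y u v - fderiv ℝ X y v u = -br (X y u) (X y v)
  geodesic : ∀ y ∈ Ω, ∀ u v, ∃ n, fderiv ℝ X y u v + L (X y u) (X y v) = X y n

variable {κ : V →L[ℝ] V →L[ℝ] ℝ} {L br : V →L[ℝ] V →L[ℝ] V} {Ω : Set H} {X : H → H →L[ℝ] V}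

/-- The derivative of the Lagrangian condition. -/
theorem IsGeodesicParam.nearlyKahler (h : IsGeodesicParam κ L br Ω X) {y : H} (hy : y ∈ Ω)
    (u v w : H) : κ (L (X y u) (X y v)) (X y w) + κ (X y v) (L (X y u) (X y w)) = 0 := by
  have hX : HasFDerivAt X (fderiv ℝ X y) y :=
    ((h.contDiffOn.contDiffAt (h.isOpen.mem_nhds hy)).differentiableAt (by norm_num)).hasFDerivAt
  have hXa : ∀ v, HasFDerivAt (fun z => X z v) ((fderiv ℝ X y).flip v) y := fun v =>
    hX.clm_apply (hasFDerivAt_const v y) |>.congr_fderiv (by ext; simp)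
  have h1 := κ.hasFDerivAt_of_bilinear (hXa v) (hXa w)
  have h2 : (fun z => κ (X z v) (X z w)) =ᶠ[nhds y] fun _ => 0 := by
    filter_upwards [h.isOpen.mem_nhds hy] with z hz using h.lagrangian z hz v w
  have h3 := (h1.congr_of_eventuallyEq h2.symm).unique (hasFDerivAt_const (0 : ℝ) y)
  have h4 := DFunLike.congr_fun h3 u
  simp at h4
  obtain ⟨n, hn⟩ := h.geodesic y hy u v
  obtain ⟨m, hm⟩ := h.geodesic y hy u w
  rw [← eq_sub_iff_add_eq] at hn hm
  rw [hn, hm, map_sub, map_sub, _root_.sub_apply, h.lagrangian y hy,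
    h.lagrangian y hy] at h4
  linear_combination -h4

/-- The derivative of the vanishing of the second fundamental form: the curvature operator maps
tangent vectors to tangent vectors. -/
theorem IsGeodesicParam.codazzi (h : IsGeodesicParam κ L br Ω X) {y : H} (hy : y ∈ Ω)
    (t u v w : H) :
    κ (L (X y t) (L (X y u) (X y v)) - L (X y u) (L (X y t) (X y v)) -
      L (br (X y t) (X y u)) (X y v)) (X y w) = 0 := by
  have hC := h.contDiffOn.contDiffAt (h.isOpen.mem_nhds hy)
  have hX : HasFDerivAt X (fderiv ℝ X y) y := (hC.differentiableAt (by norm_num)).hasFDerivAt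
  have hXa : ∀ v, HasFDerivAt (fun z => X z v) ((fderiv ℝ X y).flip v) y := fun v =>
    hX.clm_apply (hasFDerivAt_const v y) |>.congr_fderiv (by ext; simp)
  have hX2 : HasFDerivAt (fderiv ℝ X) (fderiv ℝ (fderiv ℝ X) y) y :=
    ((hC.fderiv_right (m := 1) (by norm_num)).differentiableAt (by norm_num)).hasFDerivAt
  have hX2a : ∀ u v, HasFDerivAt (fun z => fderiv ℝ X z u v)
      (((fderiv ℝ (fderiv ℝ X) y).flip u).flip v) y := fun u v =>
    (hX2.clm_apply (hasFDerivAt_const u y)).clm_apply (hasFDerivAt_const v y)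
      |>.congr_fderiv (by ext; simp)
  -- The second derivatives of `X` cancel after antisymmetrizing `key` in `t` and `u`.
  have hsymm : ∀ a b, fderiv ℝ (fderiv ℝ X) y a b = fderiv ℝ (fderiv ℝ X) y b a :=
    hC.isSymmSndFDerivAt (by simp)
  have key : ∀ t u, κ (fderiv ℝ (fderiv ℝ X) y t u v + L (fderiv ℝ X y t u) (X y v) +
      L (X y u) (fderiv ℝ X y t v)) (X y w) +
      κ (fderiv ℝ X y u v + L (X y u) (X y v)) (fderiv ℝ X y t w) = 0 := by
    intro t u
    have h1 := κ.hasFDerivAt_of_bilinear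
      ((hX2a u v).add (L.hasFDerivAt_of_bilinear (hXa u) (hXa v))) (hXa w)
    have h2 : (fun z => κ (fderiv ℝ X z u v + L (X z u) (X z v)) (X z w)) =ᶠ[nhds y]
        fun _ => 0 := by
      filter_upwards [h.isOpen.mem_nhds hy] with z hz
      obtain ⟨n, hn⟩ := h.geodesic z hz u v
      rw [hn, h.lagrangian z hz]
    have h3 := (h1.congr_of_eventuallyEq h2.symm).unique (hasFDerivAt_const (0 : ℝ) y)
    have h4 := DFunLike.congr_fun h3 t
    simp at h4
    simp only [map_add, _root_.add_apply]
    linear_combination h4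
  have k1 := key t u
  have k2 := key u t
  obtain ⟨a, ha⟩ := h.geodesic y hy u v
  obtain ⟨b, hb⟩ := h.geodesic y hy t v
  obtain ⟨c, hc⟩ := h.geodesic y hy t w
  obtain ⟨d, hd⟩ := h.geodesic y hy u w
  have n1 := h.nearlyKahler hy u b w
  have n2 := h.nearlyKahler hy t a w
  have mc := congrArg (fun z => κ (L z (X y v)) (X y w)) (h.maurerCartan y hy t u)
  have hs := congrArg (fun z => κ (z v) (X y w)) (hsymm t u)
  rw [ha] at k1
  rw [hb] at k2
  rw [← eq_sub_iff_add_eq] at ha hb hc hd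
  rw [hc, hb] at k1
  rw [hd, ha] at k2
  simp only [map_add, map_sub, map_neg, _root_.add_apply,
    _root_.sub_apply, _root_.neg_apply, h.lagrangian y hy] at k1 k2 mc hs ⊢
  linear_combination k1 - k2 - mc - hs - n1 + n2

/-- The product rule for a differential composed with a translation that depends bilinearly on the
base point. -/
theorem fderiv_bilinear_comp_fderiv (B : V →L[ℝ] V →L[ℝ] V) {F : H → V} {y : H}
    (hF : ContDiffAt ℝ 2 F y) (a b : H) :
    fderiv ℝ (fun z => (B (F z)).comp (fderiv ℝ F z)) y a b =
      B (fderiv ℝ F y a) (fderiv ℝ F y b) + B (F y) (fderiv ℝ (fderiv ℝ F) y a b) := by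
  have hF1 : HasFDerivAt F (fderiv ℝ F y) y := (hF.differentiableAt (by norm_num)).hasFDerivAt
  have hF2 : HasFDerivAt (fderiv ℝ F) (fderiv ℝ (fderiv ℝ F) y) y :=
    ((hF.fderiv_right (m := 1) (by norm_num)).differentiableAt (by norm_num)).hasFDerivAt
  have h1 := (B.hasFDerivAt.comp y hF1).clm_comp hF2
  have h2 : fderiv ℝ (fun z => (B (F z)).comp (fderiv ℝ F z)) y = _ := h1.fderiv
  rw [h2, add_comm]
  rfl

end Calculus

/-! ### The structure equations in a chart -/

theorem isBilinearMap_kahler :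
    IsBilinearMap ℝ fun x y : Vec => kahler (ofVec x) (ofVec y) where
  add_left x x' y := by
    simp [kahler, nkMetric, prodMetric, opP, opJ, ofVec, ip_eq]; ring
  smul_left c x y := by
    simp [kahler, nkMetric, prodMetric, opP, opJ, ofVec, ip_eq]; ring
  add_right x y y' := by
    simp [kahler, nkMetric, prodMetric, opP, opJ, ofVec, ip_eq]; ring
  smul_right c x y := by
    simp [kahler, nkMetric, prodMetric, opP, opJ, ofVec, ip_eq]; ring

theorem isBilinearMap_lcConn :
    IsBilinearMap ℝ fun x y : Vec => toVec (lcConn (ofVec x) (ofVec y)) where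
  add_left x x' y := by
    ext i j <;> simp [toVec, lcConn, ofVec, lie_apply] <;> ring
  smul_left c x y := by
    ext i j <;> simp [toVec, lcConn, ofVec, lie_apply] <;> ring
  add_right x y y' := by
    ext i j <;> simp [toVec, lcConn, ofVec, lie_apply] <;> ring
  smul_right c x y := by
    ext i j <;> simp [toVec, lcConn, ofVec, lie_apply] <;> ring

theorem isBilinearMap_br : IsBilinearMap ℝ fun x y : Vec => toVec (br (ofVec x) (ofVec y)) where
  add_left x x' y := by
    ext i j <;> simp [toVec, br, ofVec, lie_apply] <;> ring
  smul_left c x y := by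
    ext i j <;> simp [toVec, br, ofVec, lie_apply] <;> ring
  add_right x y y' := by
    ext i j <;> simp [toVec, br, ofVec, lie_apply] <;> ring
  smul_right c x y := by
    ext i j <;> simp [toVec, br, ofVec, lie_apply] <;> ring

/-- Left translation to the identity, written with adjugates so that it is bilinear on `ℝ⁸`. -/
def adjMul (x y : Vec) : Vec :=
  toVec ((ofVec x).1.adjugate * (ofVec y).1, (ofVec x).2.adjugate * (ofVec y).2)

theorem isBilinearMap_adjMul : IsBilinearMap ℝ adjMul where
  add_left x x' y := by
    have h : ofVec (x + x') = ofVec x + ofVec x' := rfl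
    simp only [adjMul, h, Prod.fst_add, Prod.snd_add, adjugate_add_fin_two, Matrix.add_mul]; rfl
  smul_left c x y := by
    have h : ofVec (c • x) = c • ofVec x := rfl
    simp only [adjMul, h, Prod.smul_fst, Prod.smul_snd, adjugate_smul_fin_two, Matrix.smul_mul]; rfl
  add_right x y y' := by
    have h : ofVec (y + y') = ofVec y + ofVec y' := rfl
    simp only [adjMul, h, Prod.fst_add, Prod.snd_add, Matrix.mul_add]; rfl
  smul_right c x y := by
    have h : ofVec (c • y) = c • ofVec y := rfl
    simp only [adjMul, h, Prod.smul_fst, Prod.smul_snd, Matrix.mul_smul]; rfl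

theorem adjMul_incl (x : Amb) (y : Vec) : adjMul (incl x) y = toVec (leftTr x⁻¹ (ofVec y)) := by
  rw [adjMul, incl, ofVec_toVec, leftTr, Prod.fst_inv, Prod.snd_inv,
    Matrix.SpecialLinearGroup.coe_inv, Matrix.SpecialLinearGroup.coe_inv]

/-- The Maurer-Cartan equation on the level of first derivatives. -/
theorem adjMul_sub_adjMul (x : Amb) (ξ η : MatPair) (hξ : IsTraceFree ξ) (hη : IsTraceFree η) :
    adjMul (toVec (leftTr x ξ)) (toVec (leftTr x η)) -
      adjMul (toVec (leftTr x η)) (toVec (leftTr x ξ)) = -toVec (br ξ η) := by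
  have key : ∀ (a : SL(2, ℝ)) (α β : Mat2), α.trace = 0 →
      ((a : Mat2) * α).adjugate * ((a : Mat2) * β) = -(α * β) := by
    intro a α β hα
    have h : (a : Mat2).adjugate * (a : Mat2) = 1 := by
      rw [Matrix.adjugate_mul, a.det_coe, one_smul]
    rw [Matrix.adjugate_mul_distrib, adjugate_of_trace hα, Matrix.mul_assoc,
      ← Matrix.mul_assoc _ (a : Mat2), h, Matrix.one_mul, Matrix.neg_mul]
  simp only [adjMul, ofVec_toVec, leftTr, key _ _ _ hξ.1, key _ _ _ hξ.2, key _ _ _ hη.1,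
    key _ _ _ hη.2, br, Ring.lie_def]
  ext i j <;> simp [toVec] <;> ring

variable {M : Type*} [TopologicalSpace M] [ChartedSpace (EuclideanSpace ℝ (Fin 3)) M]

/-- The immersion `f` read in the chart around `p`. -/
def chartMap (f : M → Amb) (p : M) (y : EuclideanSpace ℝ (Fin 3)) : Vec :=
  incl (f ((extChartAt (𝓡 3) p).symm y))

/-- The left-translated differential of `f` in the chart around `p`. -/
def chartForm (f : M → Amb) (p : M) (y : EuclideanSpace ℝ (Fin 3)) :
    EuclideanSpace ℝ (Fin 3) →L[ℝ] Vec :=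
  (isBilinearMap_adjMul.toContinuousBilinearMap (chartMap f p y)).comp (fderiv ℝ (chartMap f p) y)

theorem chartForm_apply (f : M → Amb) (p : M) (y v : EuclideanSpace ℝ (Fin 3)) :
    chartForm f p y v = adjMul (chartMap f p y) (fderiv ℝ (chartMap f p) y v) := rfl

variable [IsManifold (𝓡 3) ∞ M]

/-- The coordinate vector field in the direction `v` of the chart around `p`. -/
def coordField (p : M) (v : EuclideanSpace ℝ (Fin 3)) (q : M) : TangentSpace (𝓡 3) q :=
  (trivializationAt (EuclideanSpace ℝ (Fin 3)) (TangentSpace (𝓡 3)) p).symmL ℝ q v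

theorem isSmoothVF_coordField (p : M) (v : EuclideanSpace ℝ (Fin 3)) :
    IsSmoothVF (chartAt (EuclideanSpace ℝ (Fin 3)) p).source (coordField p v) := by
  set e := trivializationAt (EuclideanSpace ℝ (Fin 3)) (TangentSpace (𝓡 3) (M := M)) p with he
  have h1 : ContMDiffOn (𝓡 3) ((𝓡 3).prod 𝓘(ℝ, EuclideanSpace ℝ (Fin 3))) ∞
      (fun q : M => (q, v)) (chartAt (EuclideanSpace ℝ (Fin 3)) p).source :=
    contMDiffOn_id.prodMk contMDiffOn_const
  have h2 := (Bundle.Trivialization.contMDiffOn_symm (n := ∞) (IB := 𝓡 3) e).comp h1 (fun q hq => by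
    rw [Set.mem_preimage, Bundle.Trivialization.mem_target]
    simpa [he] using hq)
  refine h2.congr fun q hq => ?_
  have h3 := e.mk_symm (b := q) (by simpa [he] using hq) v
  rw [Function.comp_apply, ← h3, coordField, Bundle.Trivialization.symmL_apply]
  simpa using hq

/-- Coordinate vector fields are constant in the chart. -/
theorem mfderiv_extChartAt_coordField {p q : M}
    (hq : q ∈ (chartAt (EuclideanSpace ℝ (Fin 3)) p).source) (v : EuclideanSpace ℝ (Fin 3)) :
    mfderiv (𝓡 3) 𝓘(ℝ, EuclideanSpace ℝ (Fin 3)) (extChartAt (𝓡 3) p) q (coordField p v q) = v := by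
  rw [← TangentBundle.continuousLinearMapAt_trivializationAt hq, coordField]
  exact Bundle.Trivialization.continuousLinearMapAt_symmL _ (by simpa using hq) v

theorem exists_coordField_eq {p q : M}
    (hq : q ∈ (chartAt (EuclideanSpace ℝ (Fin 3)) p).source) (w : TangentSpace (𝓡 3) q) :
    ∃ v, coordField p v q = w := by
  exact ⟨_, Bundle.Trivialization.symmL_continuousLinearMapAt _ (by simpa using hq) w⟩

theorem contDiffOn_chartMap {f : M → Amb} (hf : IsLagrangianImmersion f) (p : M) :
    ContDiffOn ℝ ∞ (chartMap f p) (extChartAt (𝓡 3) p).target := by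
  rw [← contMDiffOn_iff_contDiffOn]
  exact hf.smooth.comp_contMDiffOn (contMDiffOn_extChartAt_symm p)

theorem dL_coordField {f : M → Amb} (hf : IsLagrangianImmersion f) {p q : M}
    (hq : q ∈ (chartAt (EuclideanSpace ℝ (Fin 3)) p).source) (v : EuclideanSpace ℝ (Fin 3)) :
    dL f q (coordField p v q) = ofVec (chartForm f p (extChartAt (𝓡 3) p q) v) := by
  have hq' : q ∈ (extChartAt (𝓡 3) p).source := by rwa [extChartAt_source]
  have hd : MDifferentiableAt 𝓘(ℝ, EuclideanSpace ℝ (Fin 3)) 𝓘(ℝ, Vec) (chartMap f p)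
      (extChartAt (𝓡 3) p q) :=
    (((contDiffOn_chartMap hf p).contDiffAt ((isOpen_extChartAt_target p).mem_nhds
      ((extChartAt (𝓡 3) p).map_source hq'))).differentiableAt (by simp)).mdifferentiableAt
  have he : (fun q => incl (f q)) =ᶠ[nhds q] chartMap f p ∘ extChartAt (𝓡 3) p := by
    filter_upwards [(isOpen_extChartAt_source p).mem_nhds hq'] with z hz
    simp only [Function.comp, chartMap, (extChartAt (𝓡 3) p).left_inv hz]
  have h1 : mfderiv (𝓡 3) 𝓘(ℝ, Vec) (fun q => incl (f q)) q (coordField p v q) =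
      fderiv ℝ (chartMap f p) (extChartAt (𝓡 3) p q) v := by
    rw [he.mfderiv_eq, mfderiv_comp q hd (mdifferentiableAt_extChartAt hq), mfderiv_eq_fderiv]
    exact congrArg (fderiv ℝ (chartMap f p) (extChartAt (𝓡 3) p q))
      (mfderiv_extChartAt_coordField hq v)
  have h2 : chartMap f p (extChartAt (𝓡 3) p q) = incl (f q) := by
    rw [chartMap, (extChartAt (𝓡 3) p).left_inv hq']
  rw [dL, h1, chartForm_apply, h2, adjMul_incl, ofVec_toVec]

theorem contDiffOn_chartForm {f : M → Amb} (hf : IsLagrangianImmersion f) (p : M) :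
    ContDiffOn ℝ 2 (chartForm f p) (extChartAt (𝓡 3) p).target := by
  have hF := contDiffOn_chartMap hf p
  have h1 : ContDiffOn ℝ 2 (fderiv ℝ (chartMap f p)) (extChartAt (𝓡 3) p).target :=
    hF.fderiv_of_isOpen (isOpen_extChartAt_target p) (by norm_cast)
  exact ((ContinuousLinearMap.contDiff _).comp_contDiffOn (hF.of_le (by norm_cast))).clm_comp h1

theorem covDeriv_coordField {f : M → Amb} (hf : IsLagrangianImmersion f) {p q : M}
    (hq : q ∈ (chartAt (EuclideanSpace ℝ (Fin 3)) p).source) (u v : EuclideanSpace ℝ (Fin 3)) :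
    covDeriv f (coordField p v) q (coordField p u q) =
      ofVec (fderiv ℝ (chartForm f p) (extChartAt (𝓡 3) p q) u v) +
        lcConn (ofVec (chartForm f p (extChartAt (𝓡 3) p q) u))
          (ofVec (chartForm f p (extChartAt (𝓡 3) p q) v)) := by
  have hq' : q ∈ (extChartAt (𝓡 3) p).source := by rwa [extChartAt_source]
  have hX : HasFDerivAt (fun y => chartForm f p y v)
      ((fderiv ℝ (chartForm f p) (extChartAt (𝓡 3) p q)).flip v) (extChartAt (𝓡 3) p q) :=
    ((((contDiffOn_chartForm hf p).contDiffAt ((isOpen_extChartAt_target p).mem_nhds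
      ((extChartAt (𝓡 3) p).map_source hq'))).differentiableAt (by norm_num)).hasFDerivAt.clm_apply
        (hasFDerivAt_const v _)).congr_fderiv (ContinuousLinearMap.ext fun w => by simp)
  have he : (fun z => toVec (dL f z (coordField p v z))) =ᶠ[nhds q]
      (fun y => chartForm f p y v) ∘ extChartAt (𝓡 3) p := by
    filter_upwards [(chartAt (EuclideanSpace ℝ (Fin 3)) p).open_source.mem_nhds hq] with z hz
    rw [dL_coordField hf hz]
    rfl
  have h1 : mfderiv (𝓡 3) 𝓘(ℝ, Vec) (fun z => toVec (dL f z (coordField p v z))) q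
      (coordField p u q) = fderiv ℝ (chartForm f p) (extChartAt (𝓡 3) p q) u v := by
    rw [he.mfderiv_eq, mfderiv_comp q hX.differentiableAt.mdifferentiableAt
      (mdifferentiableAt_extChartAt hq), mfderiv_eq_fderiv, hX.fderiv]
    exact congrArg ((fderiv ℝ (chartForm f p) (extChartAt (𝓡 3) p q)).flip v)
      (mfderiv_extChartAt_coordField hq u)
  rw [covDeriv, h1, dL_coordField hf hq, dL_coordField hf hq]

theorem nkMetric_comm (ξ η : MatPair) : nkMetric ξ η = nkMetric η ξ := by
  simp only [nkMetric, prodMetric, opP, ip_eq]; ring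

theorem isGeodesicParam_chartForm {f : M → Amb} (hf : IsLagrangianImmersion f)
    (hT : IsTotallyGeodesic f) (p : M) :
    IsGeodesicParam isBilinearMap_kahler.toContinuousBilinearMap
      isBilinearMap_lcConn.toContinuousBilinearMap isBilinearMap_br.toContinuousBilinearMap
      (extChartAt (𝓡 3) p).target (chartForm f p) := by
  have hΩ : IsOpen (extChartAt (𝓡 3) p).target := isOpen_extChartAt_target p
  have hF := contDiffOn_chartMap hf p
  have hmem : ∀ y ∈ (extChartAt (𝓡 3) p).target, ∃ q ∈
      (chartAt (EuclideanSpace ℝ (Fin 3)) p).source, extChartAt (𝓡 3) p q = y := by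
    intro y hy
    refine ⟨(extChartAt (𝓡 3) p).symm y, ?_, (extChartAt (𝓡 3) p).right_inv hy⟩
    rw [← extChartAt_source (𝓡 3)]
    exact (extChartAt (𝓡 3) p).map_target hy
  refine ⟨hΩ, contDiffOn_chartForm hf p, fun y hy u v => ?_, fun y hy u v => ?_, fun y hy u v => ?_⟩
  · obtain ⟨q, hq, rfl⟩ := hmem y hy
    change nkMetric (ofVec _) (opJ (ofVec _)) = 0
    rw [nkMetric_comm, ← dL_coordField hf hq, ← dL_coordField hf hq, hf.lagrangian]
  · obtain ⟨q, hq, rfl⟩ := hmem y hy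
    set y := extChartAt (𝓡 3) p q with hy_def
    have hC := hF.contDiffAt (hΩ.mem_nhds hy)
    have hsymm : ∀ a b, fderiv ℝ (fderiv ℝ (chartMap f p)) y a b =
        fderiv ℝ (fderiv ℝ (chartMap f p)) y b a := hC.isSymmSndFDerivAt (by simp; norm_cast)
    have hD : ∀ a b, fderiv ℝ (chartForm f p) y a b =
        adjMul (fderiv ℝ (chartMap f p) y a) (fderiv ℝ (chartMap f p) y b) +
          adjMul (chartMap f p y) (fderiv ℝ (fderiv ℝ (chartMap f p)) y a b) :=
      fderiv_bilinear_comp_fderiv isBilinearMap_adjMul.toContinuousBilinearMap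
        (hC.of_le (by norm_cast))
    have hx : chartMap f p y = incl (f q) := by
      rw [chartMap, hy_def, (extChartAt (𝓡 3) p).left_inv (by rwa [extChartAt_source])]
    have hX : ∀ a, fderiv ℝ (chartMap f p) y a =
        toVec (leftTr (f q) (ofVec (chartForm f p y a))) := by
      intro a
      rw [chartForm_apply, hx, adjMul_incl, ofVec_toVec, leftTr_leftTr_inv, toVec_ofVec]
    have htr : ∀ a, IsTraceFree (ofVec (chartForm f p y a)) := by
      intro a
      rw [← dL_coordField hf hq]
      exact isTraceFree_dL (hf.mdifferentiableAt q) _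
    rw [hD, hD, hsymm v u, add_sub_add_right_eq_sub, hX, hX, adjMul_sub_adjMul _ _ _ (htr u)
      (htr v)]
    rfl
  · obtain ⟨q, hq, rfl⟩ := hmem y hy
    obtain ⟨-, w, hw⟩ := hT _ _ (chartAt (EuclideanSpace ℝ (Fin 3)) p).open_source
      (isSmoothVF_coordField p v) q hq (coordField p u q)
    obtain ⟨n, rfl⟩ := exists_coordField_eq hq w
    refine ⟨n, ?_⟩
    rw [covDeriv_coordField hf hq, dL_coordField hf hq, add_zero] at hw
    exact congrArg toVec hw

/-- The two identities satisfied by the tangent spaces of a totally geodesic Lagrangian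
immersion. -/
theorem tangent_identities {f : M → Amb} (hf : IsLagrangianImmersion f)
    (hT : IsTotallyGeodesic f) (p : M) :
    (∀ u v w : TangentSpace (𝓡 3) p, kahler (lcConn (dL f p u) (dL f p v)) (dL f p w) +
      kahler (dL f p v) (lcConn (dL f p u) (dL f p w)) = 0) ∧
    ∀ t u v w : TangentSpace (𝓡 3) p,
      kahler (curv (dL f p t) (dL f p u) (dL f p v)) (dL f p w) = 0 := by
  have hp : p ∈ (chartAt (EuclideanSpace ℝ (Fin 3)) p).source := mem_chart_source _ p
  have h := isGeodesicParam_chartForm hf hT p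
  have hy := mem_extChartAt_target (I := 𝓡 3) p
  constructor
  · intro u v w
    obtain ⟨u, rfl⟩ := exists_coordField_eq hp u
    obtain ⟨v, rfl⟩ := exists_coordField_eq hp v
    obtain ⟨w, rfl⟩ := exists_coordField_eq hp w
    rw [dL_coordField hf hp, dL_coordField hf hp, dL_coordField hf hp]
    exact h.nearlyKahler hy u v w
  · intro t u v w
    obtain ⟨t, rfl⟩ := exists_coordField_eq hp t
    obtain ⟨u, rfl⟩ := exists_coordField_eq hp u
    obtain ⟨v, rfl⟩ := exists_coordField_eq hp v
    obtain ⟨w, rfl⟩ := exists_coordField_eq hp w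
    rw [dL_coordField hf hp, dL_coordField hf hp, dL_coordField hf hp, dL_coordField hf hp]
    exact h.codazzi hy t u v w

/-! ### Invariance and local constancy of the eigenvalues -/

theorem IsAdmissible.pow_six {z : Fin 3 → ℂ} (hz : IsAdmissible z) (i : Fin 3) : z i ^ 6 = 1 := by
  have h : ∀ j, z j ^ 2 = z 0 ^ 2 := by
    intro j
    rcases hz.2 j with h | h <;> rw [h]
    ring
  have h1 : (z 0 * z 1 * z 2) ^ 2 = 1 := by rw [hz.1, one_pow]
  rw [mul_pow, mul_pow, h 1, h 2] at h1
  rw [show z i ^ 6 = (z i ^ 2) ^ 3 by ring, h i, ← h1]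
  ring

theorem finite_setOf_isAdmissible : {z : Fin 3 → ℂ | IsAdmissible z}.Finite := by
  have h1 : {x : ℂ | x ^ 6 = 1}.Finite :=
    (Polynomial.nthRoots 6 (1 : ℂ)).toFinset.finite_toSet.subset fun x hx => by
      simpa [Polynomial.mem_nthRoots] using hx
  exact (Set.Finite.pi fun _ : Fin 3 => h1).subset fun z hz i _ => hz.pow_six i

section Frames

variable {M : Type*} [TopologicalSpace M] [ChartedSpace (EuclideanSpace ℝ (Fin 3)) M]

/-- A diagonalizing frame at a single point. The eigenvalue condition is stated directly, without
the operators `A` and `B`. -/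
structure IsPointFrame (f : M → Amb) (p : M) (e : Fin 3 → TangentSpace (𝓡 3) p)
    (θ : Fin 3 → ℝ) : Prop where
  orthonormal : ∀ i j, nkMetric (dL f p (e i)) (dL f p (e j)) = if i = j then delta1 i else 0
  eigen : ∀ i, opP (dL f p (e i)) =
    Real.cos (2 * θ i) • dL f p (e i) + Real.sin (2 * θ i) • opJ (dL f p (e i))

theorem nkMetric_add_left (ξ ξ' η : MatPair) :
    nkMetric (ξ + ξ') η = nkMetric ξ η + nkMetric ξ' η := by
  simp only [nkMetric, prodMetric, opP, ip_eq, Prod.fst_add, Prod.snd_add, Matrix.add_apply]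
  ring

theorem nkMetric_smul_left (c : ℝ) (ξ η : MatPair) : nkMetric (c • ξ) η = c * nkMetric ξ η := by
  simp only [nkMetric, prodMetric, opP, ip_eq, Prod.smul_fst, Prod.smul_snd, Matrix.smul_apply,
    smul_eq_mul]
  ring

theorem nkMetric_opP (ξ η : MatPair) : nkMetric (opP ξ) η = nkMetric ξ (opP η) := by
  simp only [nkMetric, prodMetric, opP, ip_eq]
  ring

theorem nkMetric_opJ_opJ (ξ η : MatPair) : nkMetric (opJ ξ) (opJ η) = nkMetric ξ η := by
  have h3 : Real.sqrt 3 ^ 2 = 3 := Real.sq_sqrt (by norm_num)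
  have h : ∀ a b : Mat2, opJ (a, b) =
      ((√3 / 3) • (a - (2 : ℝ) • b), (√3 / 3) • ((2 : ℝ) • a - b)) := by
    intro a b
    rw [opJ, one_div_sqrt_three]; rfl
  obtain ⟨a, b⟩ := ξ
  obtain ⟨c, d⟩ := η
  rw [h, h]
  simp only [nkMetric, prodMetric, opP, ip_smul_smul]
  have h4 : √3 / 3 * (√3 / 3) = 1 / 3 := by linear_combination h3 / 9
  rw [h4]
  simp only [ip_eq, Matrix.sub_apply, Matrix.smul_apply, smul_eq_mul]
  ring

theorem opP_opJ (ξ : MatPair) : opP (opJ ξ) = -opJ (opP ξ) := by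
  ext i j <;> simp [opP, opJ] <;> ring

theorem nkMetric_dL_sum (f : M → Amb) (p : M) (e : Fin 3 → TangentSpace (𝓡 3) p) (c : Fin 3 → ℝ)
    (η : MatPair) :
    nkMetric (dL f p (∑ i, c i • e i)) η = ∑ i, c i * nkMetric (dL f p (e i)) η := by
  rw [Fin.sum_univ_three, Fin.sum_univ_three, dL_add, dL_add, dL_smul, dL_smul, dL_smul,
    nkMetric_add_left, nkMetric_add_left, nkMetric_smul_left, nkMetric_smul_left,
    nkMetric_smul_left]

theorem delta1_mul_self (i : Fin 3) : delta1 i * delta1 i = 1 := by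
  fin_cases i <;> simp [delta1]

/-- The expansion of a tangent vector in a `Δ₁`-orthonormal frame. -/
theorem IsPointFrame.sum_eq {f : M → Amb} {p : M} {e : Fin 3 → TangentSpace (𝓡 3) p}
    {θ : Fin 3 → ℝ} (h : IsPointFrame f p e θ) (v : TangentSpace (𝓡 3) p) :
    v = ∑ i, (delta1 i * nkMetric (dL f p v) (dL f p (e i))) • e i := by
  have hpair : ∀ (c : Fin 3 → ℝ) (j : Fin 3),
      nkMetric (dL f p (∑ i, c i • e i)) (dL f p (e j)) = c j * delta1 j := by
    intro c j
    rw [nkMetric_dL_sum]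
    simp [h.orthonormal]
  have hli : LinearIndependent ℝ e := by
    rw [Fintype.linearIndependent_iff]
    intro c hc j
    have h1 := hpair c j
    have h0 : dL f p 0 = 0 := by simpa using dL_smul f p 0 0
    rw [hc, h0] at h1
    have h2 : nkMetric 0 (dL f p (e j)) = 0 := by simpa using nkMetric_smul_left 0 0 (dL f p (e j))
    rw [h2] at h1
    linear_combination (-delta1 j) * h1 - c j * delta1_mul_self j
  have : FiniteDimensional ℝ (TangentSpace (𝓡 3) p) :=
    inferInstanceAs (FiniteDimensional ℝ (EuclideanSpace ℝ (Fin 3)))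
  have hcard : Fintype.card (Fin 3) = Module.finrank ℝ (TangentSpace (𝓡 3) p) := by
    have : Module.finrank ℝ (TangentSpace (𝓡 3) p) =
      Module.finrank ℝ (EuclideanSpace ℝ (Fin 3)) := rfl
    rw [this, finrank_euclideanSpace]
  have hspan := hli.span_eq_top_of_card_eq_finrank' hcard
  obtain ⟨c, hc⟩ := (Submodule.mem_span_range_iff_exists_fun ℝ).1
    (hspan ▸ Submodule.mem_top : v ∈ Submodule.span ℝ (Set.range e))
  rw [← hc]
  refine Finset.sum_congr rfl fun i _ => ?_
  rw [hpair]
  congr 1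
  linear_combination (-c i) * delta1_mul_self i

/-- Vectors of two diagonalizing frames at one point are orthogonal unless they belong to the same
eigenvalue. -/
theorem IsPointFrame.phase_eq {f : M → Amb} (hf : IsLagrangianImmersion f) {p : M}
    {e e' : Fin 3 → TangentSpace (𝓡 3) p} {θ θ' : Fin 3 → ℝ} (h : IsPointFrame f p e θ)
    (h' : IsPointFrame f p e' θ') {i j : Fin 3}
    (hij : nkMetric (dL f p (e' j)) (dL f p (e i)) ≠ 0) : phase (2 * θ' j) = phase (2 * θ i) := by
  have l1 := hf.lagrangian p (e' j) (e i)
  have l2 : nkMetric (dL f p (e' j)) (opJ (dL f p (e i))) = 0 := by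
    rw [nkMetric_comm]; exact hf.lagrangian p (e i) (e' j)
  have hJ := nkMetric_opJ_opJ (dL f p (e' j)) (dL f p (e i))
  have e1 := nkMetric_opP (dL f p (e' j)) (dL f p (e i))
  have e2 := nkMetric_opP (dL f p (e' j)) (opJ (dL f p (e i)))
  rw [h.eigen, h'.eigen, nkMetric_comm _ (_ + _)] at e1
  rw [opP_opJ, h.eigen, h'.eigen, opJ_add, opJ_smul, opJ_smul, opJ_opJ,
    nkMetric_comm _ (-_), ← neg_one_smul ℝ (_ + _), ← neg_one_smul ℝ (dL f p (e i))] at e2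
  simp only [nkMetric_add_left, nkMetric_smul_left] at e1 e2
  rw [nkMetric_comm (dL f p (e i)), nkMetric_comm (opJ (dL f p (e i)))] at e1 e2
  rw [l1, l2] at e1
  rw [l2, hJ] at e2
  rw [phase_eq_iff]
  constructor
  · apply mul_right_cancel₀ hij
    linear_combination e1
  · apply mul_right_cancel₀ hij
    linear_combination e2

theorem IsPointFrame.isGeodesicFrame [IsManifold (𝓡 3) ∞ M] {f : M → Amb}
    (hf : IsLagrangianImmersion f) (hT : IsTotallyGeodesic f) {p : M}
    {e : Fin 3 → TangentSpace (𝓡 3) p} {θ : Fin 3 → ℝ} (h : IsPointFrame f p e θ) :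
    IsGeodesicFrame (fun i => dL f p (e i)) θ where
  traceFree _ := isTraceFree_dL (hf.mdifferentiableAt p) _
  orthonormal := h.orthonormal
  lagrangian _ _ := hf.lagrangian p _ _
  eigen := h.eigen
  nearlyKahler _ _ _ := (tangent_identities hf hT p).1 _ _ _
  codazzi _ _ _ _ := (tangent_identities hf hT p).2 _ _ _ _

/-- Two diagonalizing frames at one point have the same eigenvalues, up to exchanging the two
spacelike vectors: a timelike vector has a timelike component, so that the timelike eigenvalues
agree. -/
theorem IsPointFrame.swapEq [IsManifold (𝓡 3) ∞ M] {f : M → Amb}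
    (hf : IsLagrangianImmersion f) (hT : IsTotallyGeodesic f) {p : M}
    {e e' : Fin 3 → TangentSpace (𝓡 3) p} {θ θ' : Fin 3 → ℝ} (h : IsPointFrame f p e θ)
    (h' : IsPointFrame f p e' θ') :
    SwapEq (fun i => phase (2 * θ' i)) fun i => phase (2 * θ i) := by
  have hsum : ∀ {e e' : Fin 3 → TangentSpace (𝓡 3) p} {θ θ' : Fin 3 → ℝ}, IsPointFrame f p e θ →
      IsPointFrame f p e' θ' → ∀ j,
      delta1 j = ∑ i, delta1 i * nkMetric (dL f p (e' j)) (dL f p (e i)) ^ 2 := by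
    intro e e' θ θ' h h' j
    have h1 := h'.orthonormal j j
    rw [if_pos rfl] at h1
    nth_rewrite 1 [h.sum_eq (e' j)] at h1
    rw [nkMetric_dL_sum] at h1
    rw [← h1]
    refine Finset.sum_congr rfl fun i _ => ?_
    rw [nkMetric_comm (dL f p (e i))]; ring
  have hex : ∀ {e e' : Fin 3 → TangentSpace (𝓡 3) p} {θ θ' : Fin 3 → ℝ}, IsPointFrame f p e θ →
      IsPointFrame f p e' θ' → ∀ j, ∃ i, phase (2 * θ' j) = phase (2 * θ i) := by
    intro e e' θ θ' h h' j
    by_contra! hne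
    have h0 : ∀ i, nkMetric (dL f p (e' j)) (dL f p (e i)) = 0 := fun i =>
      not_not.1 fun hi => hne i (h.phase_eq hf h' hi)
    have := hsum h h' j
    simp only [h0] at this
    have h1 := delta1_mul_self j
    rw [this] at h1
    simp at h1
  refine IsAdmissible.swapEq (h'.isGeodesicFrame hf hT).isAdmissible
    (h.isGeodesicFrame hf hT).isAdmissible (h.phase_eq hf h' fun h0 => ?_) (hex h h') (hex h' h)
  have h1 := hsum h h' 0
  rw [Fin.sum_univ_three, h0] at h1
  simp only [delta1, Matrix.cons_val_zero, Matrix.cons_val_one, Matrix.cons_val] at h1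
  nlinarith [sq_nonneg (nkMetric (dL f p (e' 0)) (dL f p (e 1))),
    sq_nonneg (nkMetric (dL f p (e' 0)) (dL f p (e 2)))]

variable [IsManifold (𝓡 3) ∞ M]

theorem IsDiagonalizingFrame.isPointFrame {f : M → Amb} {U : Set M}
    {E : Fin 3 → (q : M) → TangentSpace (𝓡 3) q} {θ : Fin 3 → M → ℝ}
    (hE : IsDiagonalizingFrame f U E θ) {p : M} (hp : p ∈ U) :
    IsPointFrame f p (fun i => E i p) fun i => θ i p := by
  refine ⟨hE.orthonormal p hp, fun i => ?_⟩
  obtain ⟨A, B, hAB, h⟩ := hE.diagonal p hp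
  rw [hAB, (h i).1, (h i).2, dL_smul, dL_smul, opJ_smul]

theorem continuousOn_dL {f : M → Amb} (hf : IsLagrangianImmersion f) {U : Set M}
    {Y : (q : M) → TangentSpace (𝓡 3) q} (hY : IsSmoothVF U Y) :
    ContinuousOn (fun q => toVec (dL f q (Y q))) U := by
  have h1 : Continuous (tangentMap (𝓡 3) 𝓘(ℝ, Vec) fun q => incl (f q)) :=
    hf.smooth.continuous_tangentMap (by simp)
  have h2 : ContinuousOn (fun q => mfderiv (𝓡 3) 𝓘(ℝ, Vec) (fun q => incl (f q)) q (Y q) :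
      M → Vec) U :=
    (contMDiff_snd_tangentBundle_modelSpace (n := 0) Vec 𝓘(ℝ, Vec)).continuous.comp_continuousOn
      (h1.comp_continuousOn hY.continuousOn)
  have h3 : (fun q => toVec (dL f q (Y q))) = fun q =>
      isBilinearMap_adjMul.toContinuousBilinearMap (incl (f q))
        (mfderiv (𝓡 3) 𝓘(ℝ, Vec) (fun q => incl (f q)) q (Y q)) :=
    funext fun q => (adjMul_incl (f q) _).symm
  rw [h3]
  exact (((ContinuousLinearMap.continuous _).comp hf.smooth.continuous).continuousOn).clm_apply h2

/-- The eigenvalues of a diagonalizing frame are continuous, although the angle functions need not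
be: `cos 2θ` and `sin 2θ` are, up to sign, the products of `P E_i` with `E_i` and `J E_i`. -/
theorem IsDiagonalizingFrame.continuousOn_phase {f : M → Amb} (hf : IsLagrangianImmersion f)
    {U : Set M} {E : Fin 3 → (q : M) → TangentSpace (𝓡 3) q} {θ : Fin 3 → M → ℝ}
    (hE : IsDiagonalizingFrame f U E θ) :
    ContinuousOn (fun q i => phase (2 * θ i q)) U := by
  rw [continuousOn_pi]
  intro i
  have hc := continuousOn_dL hf (hE.smooth i)
  have hre : Continuous fun x : Vec => nkMetric (opP (ofVec x)) (ofVec x) := by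
    simp only [nkMetric, prodMetric, opP, ip_eq, ofVec, Matrix.of_apply]
    fun_prop
  have him : Continuous fun x : Vec => nkMetric (opP (ofVec x)) (opJ (ofVec x)) := by
    simp only [nkMetric, prodMetric, opP, opJ, ip_eq, ofVec, Prod.smul_mk, Matrix.smul_apply,
      Matrix.sub_apply, Matrix.of_apply, smul_eq_mul]
    fun_prop
  have hk : ContinuousOn (fun q =>
      ((delta1 i * nkMetric (opP (dL f q (E i q))) (dL f q (E i q)) : ℝ) : ℂ) +
      (delta1 i * nkMetric (opP (dL f q (E i q))) (opJ (dL f q (E i q))) : ℝ) * Complex.I) U :=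
    (Complex.continuous_ofReal.comp_continuousOn
      (continuousOn_const.mul (hre.comp_continuousOn hc))).add
    ((Complex.continuous_ofReal.comp_continuousOn
      (continuousOn_const.mul (him.comp_continuousOn hc))).mul continuousOn_const)
  refine hk.congr fun q hq => ?_
  have hp := hE.isPointFrame hq
  have h1 := hp.orthonormal i i
  rw [if_pos rfl] at h1
  have h2 := nkMetric_opJ_opJ (dL f q (E i q)) (dL f q (E i q))
  have h3 := hf.lagrangian q (E i q) (E i q)
  have h4 := nkMetric_comm (dL f q (E i q)) (opJ (dL f q (E i q)))
  have h5 := delta1_mul_self i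
  have hcos : delta1 i * nkMetric (opP (dL f q (E i q))) (dL f q (E i q)) =
      Real.cos (2 * θ i q) := by
    rw [hp.eigen, nkMetric_add_left, nkMetric_smul_left, nkMetric_smul_left, h3, h1]
    linear_combination Real.cos (2 * θ i q) * h5
  have hsin : delta1 i * nkMetric (opP (dL f q (E i q))) (opJ (dL f q (E i q))) =
      Real.sin (2 * θ i q) := by
    rw [hp.eigen, nkMetric_add_left, nkMetric_smul_left, nkMetric_smul_left, h2, h4, h3, h1]
    linear_combination Real.sin (2 * θ i q) * h5
  beta_reduce
  rw [hcos, hsin, phase, Complex.exp_mul_I, Complex.ofReal_cos, Complex.ofReal_sin]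

theorem IsDiagonalizingFrame.phase_eq_of_isPreconnected {f : M → Amb}
    (hf : IsLagrangianImmersion f) (hT : IsTotallyGeodesic f) {U : Set M}
    {E : Fin 3 → (q : M) → TangentSpace (𝓡 3) q} {θ : Fin 3 → M → ℝ}
    (hE : IsDiagonalizingFrame f U E θ) (hU : IsPreconnected U) {p q : M} (hp : p ∈ U)
    (hq : q ∈ U) : (fun i => phase (2 * θ i p)) = fun i => phase (2 * θ i q) :=
  hU.constant_of_mapsTo finite_setOf_isAdmissible.isDiscrete (hE.continuousOn_phase hf)
    (fun _ hx => ((hE.isPointFrame hx).isGeodesicFrame hf hT).isAdmissible) hp hq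

/-- On a connected manifold all diagonalizing frames have the same eigenvalues, up to exchanging
the spacelike vectors. -/
theorem exists_swapEq_of_connected [ConnectedSpace M] {f : M → Amb}
    (hf : IsLagrangianImmersion f) (hT : IsTotallyGeodesic f) (hD : IsDiagonalizableType f) :
    ∃ z, IsAdmissible z ∧ ∀ (p : M) (e : Fin 3 → TangentSpace (𝓡 3) p) (θ : Fin 3 → ℝ),
      IsPointFrame f p e θ → SwapEq (fun i => phase (2 * θ i)) z := by
  -- The set of eigenvalue triples at a point, closed under the exchange, is locally constant.
  let τ : M → Set (Fin 3 → ℂ) := fun p =>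
    {z | ∃ e θ, IsPointFrame f p e θ ∧ SwapEq z fun i => phase (2 * θ i)}
  have hτ : ∀ {p : M} {e : Fin 3 → TangentSpace (𝓡 3) p} {θ : Fin 3 → ℝ},
      IsPointFrame f p e θ → τ p = {z | SwapEq z fun i => phase (2 * θ i)} := by
    intro p e θ h
    ext z
    constructor
    · rintro ⟨e', θ', h', hz⟩
      exact hz.trans (h.swapEq hf hT h')
    · exact fun hz => ⟨e, θ, h, hz⟩
  have hloc : IsLocallyConstant τ := by
    rw [IsLocallyConstant.iff_eventually_eq]
    intro p
    obtain ⟨U, hU, hp, E, θ, hE⟩ := hD p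
    have hadm : ∀ q ∈ U, IsAdmissible fun i => phase (2 * θ i q) := fun q hq =>
      ((hE.isPointFrame hq).isGeodesicFrame hf hT).isAdmissible
    -- The remaining admissible values form a finite, hence closed, set.
    have hclosed := (finite_setOf_isAdmissible.subset
      (Set.sdiff_subset (t := {fun i => phase (2 * θ i p)}))).isClosed
    have hev := ((hE.continuousOn_phase hf).continuousAt (hU.mem_nhds hp)).eventually
      (hclosed.isOpen_compl.mem_nhds (by simp))
    filter_upwards [hU.mem_nhds hp, hev] with q hq hq'
    have heq : (fun i => phase (2 * θ i q)) = fun i => phase (2 * θ i p) := by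
      by_contra hne
      exact hq' ⟨hadm q hq, hne⟩
    rw [hτ (hE.isPointFrame hq), hτ (hE.isPointFrame hp), heq]
  obtain ⟨p₀⟩ := (inferInstance : Nonempty M)
  obtain ⟨U, -, hp₀, E, θ₀, hE⟩ := hD p₀
  refine ⟨_, ((hE.isPointFrame hp₀).isGeodesicFrame hf hT).isAdmissible, fun p e θ h => ?_⟩
  have hmem : (fun i => phase (2 * θ i)) ∈ τ p := ⟨e, θ, h, SwapEq.refl _⟩
  rw [hloc.apply_eq_of_preconnectedSpace p p₀, hτ (hE.isPointFrame hp₀)] at hmem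
  exact hmem

end Frames

end PseudoNK

end

theorem lemma4p5 {M : Type*} [TopologicalSpace M] [ChartedSpace (EuclideanSpace ℝ (Fin 3)) M]
    [IsManifold (𝓡 3) ∞ M] [ConnectedSpace M] (f : M → Amb)
    (hLag : IsLagrangianImmersion f) (hTG : IsTotallyGeodesic f)
    (hDiag : IsDiagonalizableType f) :
    ∃ φ ∈ Subgroup.closure ({phi1, phi2} : Set (Equiv.Perm Amb)),
      IsAmbIsometry φ ∧ IsLagrangianImmersion (fun p => φ (f p)) ∧
      ∃ c : Fin 3 → ℝ,
        (c = ![4 * Real.pi / 3, 4 * Real.pi / 3, 4 * Real.pi / 3] ∨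
          c = ![0, Real.pi, Real.pi] ∨ c = ![Real.pi, Real.pi, 0]) ∧
        ∀ (U : Set M) (E : Fin 3 → (q : M) → TangentSpace (𝓡 3) q) (θ : Fin 3 → M → ℝ),
          IsOpen U → IsPreconnected U → IsDiagonalizingFrame f U E θ →
          ∃ (E' : Fin 3 → (q : M) → TangentSpace (𝓡 3) q) (θ' : Fin 3 → M → ℝ),
            (E' = E ∨ E' = swapFrame E) ∧
            IsDiagonalizingFrame (fun p => φ (f p)) U E' θ' ∧
            ∀ p ∈ U, ∀ i, 2 * θ' i p = c i := by
  obtain ⟨z, hz, hframe⟩ := exists_swapEq_of_connected hLag hTG hDiag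
  obtain ⟨r, c, hc, hzc⟩ := hz.exists_phase
  obtain ⟨Φ, K, hrot⟩ := exists_isRotation_rho_pow r
  have hmem : rho ^ r ∈ Subgroup.closure ({phi1, phi2} : Set (Equiv.Perm Amb)) :=
    Subgroup.pow_mem _ (Subgroup.mul_mem _ (Subgroup.subset_closure (by simp))
      (Subgroup.subset_closure (by simp))) r
  refine ⟨rho ^ r, hmem, hrot.isAmbIsometry, hrot.isLagrangianImmersion hLag, c, hc,
    fun U E θ _ hU hE => ?_⟩
  -- A frame with the eigenvalues listed by `c` up to the rotation is diagonalizing for the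
  -- rotated immersion with the constant angles `c i / 2`.
  have key : ∀ {E' : Fin 3 → (q : M) → TangentSpace (𝓡 3) q} {η : Fin 3 → M → ℝ},
      IsDiagonalizingFrame f U E' η →
      (∀ p ∈ U, ∀ i, phase (2 * η i p) = phase (r * (2 * Real.pi / 3) + c i)) →
      IsDiagonalizingFrame (fun p => (rho ^ r) (f p)) U E' fun i _ => c i / 2 := by
    intro E' η hE' h
    refine hrot.isDiagonalizingFrame hLag hE' fun p hp i => ?_
    rw [phase_add, h p hp i, ← phase_add]
    congr 1; ring
  rcases U.eq_empty_or_nonempty with rfl | ⟨p₀, hp₀⟩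
  · exact ⟨E, fun i _ => c i / 2, Or.inl rfl, key hE (by simp), by simp⟩
  have hconst := fun p hp => hE.phase_eq_of_isPreconnected hLag hTG hU (p := p) (q := p₀) hp hp₀
  have hswap := (hframe p₀ _ _ (hE.isPointFrame hp₀)).trans hzc
  rcases hswap with h | h
  · exact ⟨E, fun i _ => c i / 2, Or.inl rfl,
      key hE fun p hp i => congrFun ((hconst p hp).trans h) i, fun p _ i => by ring⟩
  · refine ⟨swapFrame E, fun i _ => c i / 2, Or.inr rfl, key hE.swap fun p hp i => ?_,
      fun p _ i => by ring⟩
    have := congrFun ((hconst p hp).trans h) (Equiv.swap 1 2 i)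
    simpa using this
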